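/- Let $G$ be a discrete group and let $\mathcal B=(B_t)_{t\in G}$ be a Fell bundle over $G$, with unit element $e\in G$ and unit fiber the $C^*$-algebra $B_e$. Ideals of $C^*$-algebras are closed and two-sided. An ideal of $\mathcal B$ is a family $\mathcal I=(I_t)_{t\in G}$ of closed subspaces $I_t\subseteq B_t$ that is closed under the product and the involution of $\mathcal B$ and satisfies $B_sI_t\subseteq I_{st}$ and $I_sB_t\subseteq I_{st}$ for all $s,t\in G$; then $\mathcal I$ and the quotient $\mathcal B/\mathcal I=(B_t/I_t)_{t\in G}$ are Fell bundles over $G$. Let $\ell^2(\mathcal B)$ be the right Hilbert $B_e$-module of the sections $\xi$ of $\mathcal B$ for which $\sum_t\xi(t)^*\xi(t)$ converges (unconditionally) in $B_e$, and let $C^*_r(\mathcal B)$ be the $C^*$-algebra of adjointable operators on $\ell^2(\mathcal B)$ generated by the operators $\Lambda_b$ $(b\in B_t,\ t\in G)$, $(\Lambda_b\xi)(s)=b\,\xi(t^{-1}s)$. View $B_e$ as a subalgebra of $C^*_r(\mathcal B)$ through $b\mapsto\Lambda_b$, and let $E:C^*_r(\mathcal B)\to B_e$ be the canonical conditional expectation,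 the continuous linear map with $E(\Lambda_b)=b$ for $b\in B_e$ and $E(\Lambda_b)=0$ for $b\in B_t$, $t\neq e$. For an ideal $\mathcal I$ of $\mathcal B$, the inclusion $\mathcal I\to\mathcal B$ and the quotient map $\mathcal B\to\mathcal B/\mathcal I$ induce homomorphisms $i_r:C^*_r(\mathcal I)\to C^*_r(\mathcal B)$ and $p_r:C^*_r(\mathcal B)\to C^*_r(\mathcal B/\mathcal I)$, and $C^*_r(\mathcal I)$ is identified with the ideal of $C^*_r(\mathcal B)$ that is the closed linear span of $\{\Lambda_b: b\in I_t,\ t\in G\}$. The ideals of $\mathcal B$ and the ideals of $C^*_r(\mathcal B)$ form lattices under inclusion. Say that * $\mathcal B$ has the exactness property if, for every ideal $\mathcal I$ of $\mathcal B$, the sequence $0\to C^*_r(\mathcal I)\xrightarrow{i_r}C^*_r(\mathcal B)\xrightarrow{p_r}C^*_r(\mathcal B/\mathcal I)\to0$ is exact; * $\mathcal B$ has the residual intersection property if, for every ideal $\mathcal I$ of $\mathcal B$, every nonzero ideal of $C^*_r(\mathcal B/\mathcal I)$ has nonzero intersection with $B_e/I_e$; * an ideal $J$ of $C^*_r(\mathcal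 B)$ is diagonal invariant if $E(J)\subseteq J$. Then the following are equivalent: (i) the map $\mathcal I\mapsto C^*_r(\mathcal I)$ is an isomorphism from the lattice of ideals of $\mathcal B$ onto the lattice of ideals of $C^*_r(\mathcal B)$; (ii) $\mathcal B$ has the exactness property and every ideal of $C^*_r(\mathcal B)$ is diagonal invariant; (iii) $\mathcal B$ has the exactness property and the residual intersection property. -/

import Mathlib

universe u v w

/-- A Fell bundle over the discrete group `G`: a family of complex Banach spaces `B_t`, `t ∈ G`,
with an associative bilinear multiplication `B_s × B_t → B_{st}` and a conjugate-linear,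
antimultiplicative, involutive and isometric operation `* : B_t → B_{t⁻¹}`, such that
`‖a b‖ ≤ ‖a‖ ‖b‖`, `‖a* a‖ = ‖a‖ ^ 2`, and `a* a` is positive in the C*-algebra `B_1`, that is,
of the form `c* c` with `c ∈ B_1`.

To avoid transports between the fibers over equal group elements, the product
of `a ∈ B_s` and `b ∈ B_t` is available in `B_u` for each proof of `s * t = u`, and `a*` is available
in `B_t` for each proof of `s⁻¹ = t`. -/
structure FellBundle (G : Type u) [Group G] where
  fiber : G → Type v
  [normed : ∀ t, NormedAddCommGroup (fiber t)]
  [normedSpace : ∀ t, NormedSpace ℂ (fiber t)]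
  [complete : ∀ t, CompleteSpace (fiber t)]
  mul : ∀ {s t u : G}, s * t = u → fiber s → fiber t → fiber u
  adj : ∀ {s t : G}, s⁻¹ = t → fiber s → fiber t
  mul_add' : ∀ {s t u : G} (h : s * t = u) (a : fiber s) (b c : fiber t),
    mul h a (b + c) = mul h a b + mul h a c
  add_mul' : ∀ {s t u : G} (h : s * t = u) (a b : fiber s) (c : fiber t),
    mul h (a + b) c = mul h a c + mul h b c
  mul_smul' : ∀ {s t u : G} (h : s * t = u) (z : ℂ) (a : fiber s) (b : fiber t),
    mul h a (z • b) = z • mul h a b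
  smul_mul' : ∀ {s t u : G} (h : s * t = u) (z : ℂ) (a : fiber s) (b : fiber t),
    mul h (z • a) b = z • mul h a b
  mul_assoc' : ∀ {s t u st tu stu : G} (h₁ : s * t = st) (h₂ : st * u = stu) (h₃ : t * u = tu)
    (h₄ : s * tu = stu) (a : fiber s) (b : fiber t) (c : fiber u),
    mul h₂ (mul h₁ a b) c = mul h₄ a (mul h₃ b c)
  adj_add' : ∀ {s t : G} (h : s⁻¹ = t) (a b : fiber s), adj h (a + b) = adj h a + adj h b
  adj_smul' : ∀ {s t : G} (h : s⁻¹ = t) (z : ℂ) (a : fiber s),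
    adj h (z • a) = (starRingEnd ℂ z) • adj h a
  adj_adj' : ∀ {s t : G} (h : s⁻¹ = t) (h' : t⁻¹ = s) (a : fiber s), adj h' (adj h a) = a
  adj_mul' : ∀ {s t u s' t' u' : G} (h : s * t = u) (hs : s⁻¹ = s') (ht : t⁻¹ = t')
    (hu : u⁻¹ = u') (h' : t' * s' = u') (a : fiber s) (b : fiber t),
    adj hu (mul h a b) = mul h' (adj ht b) (adj hs a)
  norm_mul_le' : ∀ {s t u : G} (h : s * t = u) (a : fiber s) (b : fiber t),
    ‖mul h a b‖ ≤ ‖a‖ * ‖b‖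
  norm_adj' : ∀ {s t : G} (h : s⁻¹ = t) (a : fiber s), ‖adj h a‖ = ‖a‖
  norm_adj_mul_self' : ∀ {s t : G} (h : s⁻¹ = t) (h' : t * s = 1) (a : fiber s),
    ‖mul h' (adj h a) a‖ = ‖a‖ ^ 2
  adj_mul_self_pos' : ∀ {s t : G} (h : s⁻¹ = t) (h' : t * s = 1) (a : fiber s),
    ∃ c : fiber 1, mul h' (adj h a) a = mul (one_mul 1) (adj inv_one c) c

namespace FellBundle

attribute [instance] FellBundle.normed FellBundle.normedSpace FellBundle.complete

variable {G : Type u} [Group G] (B : FellBundle.{u, v} G)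

section basic

variable {s t r : G}

/-- Multiplication as a bilinear map. -/
noncomputable def mulL (h : s * t = r) : B.fiber s →ₗ[ℂ] B.fiber t →ₗ[ℂ] B.fiber r :=
  LinearMap.mk₂ ℂ (B.mul h) (B.add_mul' h) (fun z a b => B.smul_mul' h z a b) (B.mul_add' h)
    (fun z a b => B.mul_smul' h z a b)

theorem mulL_apply (h : s * t = r) (a : B.fiber s) (b : B.fiber t) :
    B.mulL h a b = B.mul h a b := rfl

theorem mul_zero' (h : s * t = r) (a : B.fiber s) : B.mul h a 0 = 0 := map_zero (B.mulL h a)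

theorem zero_mul' (h : s * t = r) (b : B.fiber t) : B.mul h 0 b = 0 :=
  map_zero ((B.mulL h).flip b)

theorem mul_sub' (h : s * t = r) (a : B.fiber s) (b c : B.fiber t) :
    B.mul h a (b - c) = B.mul h a b - B.mul h a c := map_sub (B.mulL h a) b c

theorem sub_mul' (h : s * t = r) (a b : B.fiber s) (c : B.fiber t) :
    B.mul h (a - b) c = B.mul h a c - B.mul h b c := map_sub ((B.mulL h).flip c) a b

theorem adj_zero' (h : s⁻¹ = t) : B.adj h 0 = 0 := by
  have := B.adj_smul' h 0 0
  simpa using this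

theorem adj_neg' (h : s⁻¹ = t) (a : B.fiber s) : B.adj h (-a) = - B.adj h a := by
  have := B.adj_smul' h (-1) a
  simpa using this

theorem adj_sub' (h : s⁻¹ = t) (a b : B.fiber s) :
    B.adj h (a - b) = B.adj h a - B.adj h b := by
  rw [sub_eq_add_neg, B.adj_add', B.adj_neg', ← sub_eq_add_neg]

end basic

/-- The unit fiber of a Fell bundle is a C*-algebra. -/
noncomputable instance unitFiber : NonUnitalCStarAlgebra (B.fiber 1) where
  __ := B.normed 1
  dist_eq := (B.normed 1).dist_eq
  mul a b := B.mul (one_mul 1) a b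
  left_distrib a b c := B.mul_add' _ a b c
  right_distrib a b c := B.add_mul' _ a b c
  zero_mul a := B.zero_mul' _ a
  mul_zero a := B.mul_zero' _ a
  mul_assoc a b c := B.mul_assoc' _ _ _ _ a b c
  norm_mul_le a b := B.norm_mul_le' _ a b
  star a := B.adj inv_one a
  star_involutive a := B.adj_adj' _ _ a
  star_mul a b := B.adj_mul' _ _ _ _ _ a b
  star_add a b := B.adj_add' _ a b
  norm_mul_self_le a := (B.norm_adj_mul_self' inv_one (one_mul 1) a ▸ (pow_two ‖a‖)).ge
  toNormedSpace := B.normedSpace 1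
  smul_assoc z a b := B.smul_mul' _ z a b
  smul_comm z a b := (B.mul_smul' _ z a b).symm
  star_smul z a := B.adj_smul' _ z a
  complete := (B.complete 1).complete

noncomputable instance : PartialOrder (B.fiber 1) := CStarAlgebra.spectralOrder _
instance : StarOrderedRing (B.fiber 1) := CStarAlgebra.spectralOrderedRing _

theorem mul_one_def (a b : B.fiber 1) : B.mul (one_mul 1) a b = a * b := rfl
theorem star_def (a : B.fiber 1) : B.adj inv_one a = star a := rfl

/-- The `B_1`-valued inner product `⟨x, y⟩ = x* y` of the right Hilbert module `B_t`. -/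
def ip {t : G} (x y : B.fiber t) : B.fiber 1 := B.mul (inv_mul_cancel t) (B.adj rfl x) y

section ip
variable {t : G}

theorem ip_add_right (x y z : B.fiber t) : B.ip x (y + z) = B.ip x y + B.ip x z :=
  B.mul_add' _ _ _ _
theorem ip_add_left (x y z : B.fiber t) : B.ip (x + y) z = B.ip x z + B.ip y z := by
  simp only [ip, B.adj_add', B.add_mul']
theorem ip_smul_right (c : ℂ) (x y : B.fiber t) : B.ip x (c • y) = c • B.ip x y :=
  B.mul_smul' _ _ _ _
theorem ip_smul_left (c : ℂ) (x y : B.fiber t) :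
    B.ip (c • x) y = (starRingEnd ℂ c) • B.ip x y := by
  simp only [ip, B.adj_smul', B.smul_mul']
theorem ip_zero_right (x : B.fiber t) : B.ip x 0 = 0 := B.mul_zero' _ _
theorem ip_zero_left (x : B.fiber t) : B.ip 0 x = 0 := by
  simp only [ip, B.adj_zero', B.zero_mul']
theorem star_ip (x y : B.fiber t) : star (B.ip x y) = B.ip y x := by
  rw [← B.star_def, ip, B.adj_mul' _ (inv_inv t) rfl inv_one (inv_mul_cancel t), B.adj_adj']; rfl
theorem ip_self_nonneg (x : B.fiber t) : 0 ≤ B.ip x x := by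
  obtain ⟨c, hc⟩ := B.adj_mul_self_pos' rfl (inv_mul_cancel t) x
  rw [ip, hc]
  exact star_mul_self_nonneg c
theorem norm_ip_self (x : B.fiber t) : ‖B.ip x x‖ = ‖x‖ ^ 2 := B.norm_adj_mul_self' _ _ _
theorem ip_mul_right (x y : B.fiber t) (c : B.fiber 1) :
    B.ip x (B.mul (mul_one t) y c) = B.ip x y * c :=
  (B.mul_assoc' _ _ _ _ _ _ _).symm
theorem ip_mul_left (x y : B.fiber t) (c : B.fiber 1) :
    B.ip (B.mul (mul_one t) x c) y = star c * B.ip x y := by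
  rw [← B.star_ip, B.ip_mul_right, star_mul, B.star_ip]
theorem ip_adj {s r : G} (h : s * t = r) (h' : s⁻¹ * r = t) (b : B.fiber s) (x : B.fiber t)
    (y : B.fiber r) :
    B.ip (B.mul h b x) y = B.ip x (B.mul h' (B.adj rfl b) y) := by
  subst h
  rw [ip, ip, B.adj_mul' _ rfl rfl rfl (mul_inv_rev s t).symm, B.mul_assoc']

theorem ip_one (x y : B.fiber 1) : B.ip x y = star x * y := by
  rw [← B.star_def, ← B.mul_one_def, ip]
  have : ∀ (g : G) (h : (1 : G)⁻¹ = g) (h' : g * 1 = 1), B.mul h' (B.adj h x) y =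
      B.mul (one_mul 1) (B.adj inv_one x) y := by
    intro g h h'
    obtain rfl : g = 1 := by simpa using h'
    rfl
  exact this _ _ _

end ip

theorem sq_le_norm_smul {A : Type*} [NonUnitalCStarAlgebra A] [PartialOrder A] [StarOrderedRing A]
    {c : A} (hc : 0 ≤ c) : c * c ≤ ‖c‖ • c := by
  obtain ⟨e, rfl⟩ := CStarAlgebra.nonneg_iff_eq_star_mul_self.mp hc
  have := CStarAlgebra.star_left_conjugate_le_norm_smul (a := e) (b := e * star e)
    (IsSelfAdjoint.mul_star_self e)
  rw [CStarRing.norm_self_mul_star, ← CStarRing.norm_star_mul_self (x := e)] at this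
  simpa only [mul_assoc] using this

theorem ip_real_smul_right {t : G} (c : ℝ) (x y : B.fiber t) :
    B.ip x (c • y) = c • B.ip x y := by
  simpa using B.ip_smul_right (c : ℂ) x y
theorem ip_real_smul_left {t : G} (c : ℝ) (x y : B.fiber t) :
    B.ip (c • x) y = c • B.ip x y := by
  simpa using B.ip_smul_left (c : ℂ) x y

theorem ip_sub_right {t : G} (x y z : B.fiber t) : B.ip x (y - z) = B.ip x y - B.ip x z :=
  B.mul_sub' _ _ _ _
theorem ip_sub_left {t : G} (x y z : B.fiber t) : B.ip (x - y) z = B.ip x z - B.ip y z := by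
  simp only [ip, B.adj_sub', B.sub_mul']

/-- `⟨x, c x⟩ ≤ ‖c‖ ⟨x, x⟩` for positive `c`. -/
theorem ip_mul_le {t : G} {c : B.fiber 1} (hc : 0 ≤ c) (x : B.fiber t) :
    B.ip x (B.mul (one_mul t) c x) ≤ ‖c‖ • B.ip x x := by
  rcases eq_or_ne c 0 with rfl | hc0
  · simp [B.zero_mul', B.ip_zero_right]
  have hn : 0 < ‖c‖ := norm_pos_iff.mpr hc0
  have hstar : star c = c := (IsSelfAdjoint.of_nonneg hc).star_eq
  have key : ∀ d : B.fiber 1, star d = d → ∀ y : B.fiber t, B.ip (B.mul (one_mul t) d x) y =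
      B.ip x (B.mul (one_mul t) d y) := by
    intro d hd y
    rw [B.ip_adj (one_mul t) (by simp)]
    congr 1
    have : ∀ (g : G) (h : (1 : G)⁻¹ = g) (h' : g * t = t), B.mul h' (B.adj h d) y =
      B.mul (one_mul t) (B.adj inv_one d) y := by
      intro g h h'
      obtain rfl : g = 1 := by simpa using h'
      rfl
    rw [this, B.star_def, hd]
  have h1 : 0 ≤ B.ip x (B.mul (one_mul t) (‖c‖ • c - c * c) x) := by
    obtain ⟨e, he⟩ := CStarAlgebra.nonneg_iff_eq_star_mul_self.mp
      (sub_nonneg.mpr (sq_le_norm_smul hc))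
    rw [he]
    have := B.ip_self_nonneg (B.mul (one_mul t) e x)
    rw [B.ip_adj (one_mul t) (by simp)] at this
    convert this using 2
    have h2 : ∀ (g : G) (h : (1 : G)⁻¹ = g) (h' : g * t = t),
      B.mul h' (B.adj h e) (B.mul (one_mul t) e x) =
      B.mul (one_mul t) (star e * e) x := by
      intro g h h'
      obtain rfl : g = 1 := by simpa using h'
      exact (B.mul_assoc' _ _ _ _ _ _ _).symm
    exact (h2 _ _ _).symm
  have h2 := B.ip_self_nonneg (B.mul (one_mul t) c x - ‖c‖ • x)
  have hcc : B.mul (one_mul t) (c * c) x = B.mul (one_mul t) c (B.mul (one_mul t) c x) :=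
    B.mul_assoc' _ _ _ _ _ _ _
  have hsm : B.mul (one_mul t) (‖c‖ • c) x = ‖c‖ • B.mul (one_mul t) c x := by
    simpa using B.smul_mul' (one_mul t) (‖c‖ : ℂ) c x
  rw [B.sub_mul', hcc, hsm, B.ip_sub_right, B.ip_real_smul_right] at h1
  simp only [B.ip_sub_right, B.ip_sub_left, B.ip_real_smul_right, B.ip_real_smul_left,
    key c hstar] at h2
  set P := B.ip x (B.mul (one_mul t) c (B.mul (one_mul t) c x))
  set Q := B.ip x (B.mul (one_mul t) c x)
  set R := B.ip x x
  have h3 : 0 ≤ ‖c‖ • (‖c‖ • R - Q) := by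
    have := add_nonneg h1 h2
    convert this using 1
    rw [smul_sub]; abel
  have h4 := smul_nonneg (inv_nonneg.mpr hn.le) h3
  rw [inv_smul_smul₀ hn.ne'] at h4
  exact sub_nonneg.mp h4

theorem ip_mul_mul_le {s t r : G} (h : s * t = r) (b : B.fiber s) (x : B.fiber t) :
    B.ip (B.mul h b x) (B.mul h b x) ≤ ‖b‖ ^ 2 • B.ip x x := by
  subst h
  have : B.ip (B.mul rfl b x) (B.mul rfl b x) = B.ip x (B.mul (one_mul t) (B.ip b b) x) := by
    rw [B.ip_adj rfl (inv_mul_cancel_left s t)]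
    congr 1
    exact (B.mul_assoc' _ _ _ _ _ _ _).symm
  rw [this, ← B.norm_ip_self]
  exact B.ip_mul_le (B.ip_self_nonneg b) x

/-! ### Finite sums of inner products -/

/-- The partial sum over the finite set `F` of the inner product of two sections. -/
noncomputable def fip (F : Finset G) (x y : ∀ t, B.fiber t) : B.fiber 1 :=
  ∑ t ∈ F, B.ip (x t) (y t)

theorem fip_self_nonneg (F : Finset G) (x : ∀ t, B.fiber t) : 0 ≤ B.fip F x x :=
  Finset.sum_nonneg fun t _ => B.ip_self_nonneg (x t)

theorem fip_add_right (F : Finset G) (x y z : ∀ t, B.fiber t) :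
    B.fip F x (y + z) = B.fip F x y + B.fip F x z := by
  simp [fip, B.ip_add_right, Finset.sum_add_distrib]

theorem fip_add_left (F : Finset G) (x y z : ∀ t, B.fiber t) :
    B.fip F (x + y) z = B.fip F x z + B.fip F y z := by
  simp [fip, B.ip_add_left, Finset.sum_add_distrib]

theorem star_fip (F : Finset G) (x y : ∀ t, B.fiber t) : star (B.fip F x y) = B.fip F y x := by
  simp [fip, B.star_ip]

theorem norm_fip_sq_le (F : Finset G) (x y : ∀ t, B.fiber t) :
    ‖B.fip F x y‖ ^ 2 ≤ ‖B.fip F x x‖ * ‖B.fip F y y‖ := by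
  set a := B.fip F x x with ha
  set b := B.fip F y y with hb
  set c := B.fip F x y with hc
  have ha0 : 0 ≤ a := B.fip_self_nonneg F x
  let z : ℝ → ∀ t, B.fiber t := fun l t => B.mul (mul_one t) (x t) c - l • y t
  have hz : ∀ l : ℝ, B.fip F (z l) (z l) = star c * a * c - l • (star c * c) - l • (star c * c)
      + (l * l) • b := by
    intro l
    have h1 : ∀ t, B.ip (z l t) (z l t) = star c * B.ip (x t) (x t) * c
        - l • (star c * B.ip (x t) (y t)) - l • (B.ip (y t) (x t) * c)
        + (l * l) • B.ip (y t) (y t) := by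
      intro t
      simp only [z, B.ip_sub_right, B.ip_sub_left, B.ip_real_smul_right, B.ip_real_smul_left,
        B.ip_mul_left, B.ip_mul_right, mul_smul, mul_assoc]
      abel
    have h2 : star c = B.fip F y x := B.star_fip F x y
    simp only [fip, h1, Finset.sum_add_distrib, Finset.sum_sub_distrib, ← Finset.smul_sum,
      ← Finset.sum_mul, ← Finset.mul_sum]
    rw [ha, hb, hc]
    simp only [fip] at h2 ⊢
    rw [← h2, hc]
    rfl
  have h0 := B.fip_self_nonneg F (z ‖a‖)
  rw [hz] at h0
  have h1 : star c * a * c ≤ ‖a‖ • (star c * c) :=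
    CStarAlgebra.star_left_conjugate_le_norm_smul (IsSelfAdjoint.of_nonneg ha0)
  have h2 : ‖a‖ • (star c * c) ≤ (‖a‖ * ‖a‖) • b := by
    have := add_nonneg h0 (sub_nonneg.mpr h1)
    rw [← sub_nonneg]
    convert this using 1
    abel
  rcases eq_or_ne a 0 with h | h
  · have hx : ∀ t ∈ F, x t = 0 := by
      intro t ht
      have h3 := (Finset.sum_eq_zero_iff_of_nonneg
        (fun t _ => B.ip_self_nonneg (x t))).mp (ha.symm.trans h) t ht
      have h4 := B.norm_ip_self (x t)
      rw [h3, norm_zero] at h4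
      simpa using h4.symm
    have : c = 0 := by
      rw [hc]
      exact Finset.sum_eq_zero fun t ht => by rw [hx t ht, B.ip_zero_left]
    simp [this, h]
  · have hn : 0 < ‖a‖ := norm_pos_iff.mpr h
    have h3 := CStarAlgebra.norm_le_norm_of_nonneg_of_le
      (smul_nonneg hn.le (star_mul_self_nonneg c)) h2
    rw [norm_smul, norm_smul, CStarRing.norm_star_mul_self] at h3
    simp only [norm_norm, norm_mul] at h3
    rw [mul_assoc] at h3
    have := le_of_mul_le_mul_left h3 hn
    nlinarith

theorem norm_fip_le (F : Finset G) (x y : ∀ t, B.fiber t) :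
    ‖B.fip F x y‖ ≤ √‖B.fip F x x‖ * √‖B.fip F y y‖ := by
  rw [← Real.sqrt_mul (norm_nonneg _)]
  exact Real.le_sqrt_of_sq_le (B.norm_fip_sq_le F x y)

/-- The seminorm attached to a finite set of indices. -/
noncomputable def fnorm (F : Finset G) (x : ∀ t, B.fiber t) : ℝ := √‖B.fip F x x‖

theorem fnorm_nonneg (F : Finset G) (x : ∀ t, B.fiber t) : 0 ≤ B.fnorm F x := Real.sqrt_nonneg _

theorem fnorm_sq (F : Finset G) (x : ∀ t, B.fiber t) : B.fnorm F x ^ 2 = ‖B.fip F x x‖ :=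
  Real.sq_sqrt (norm_nonneg _)

theorem fnorm_add_le (F : Finset G) (x y : ∀ t, B.fiber t) :
    B.fnorm F (x + y) ≤ B.fnorm F x + B.fnorm F y := by
  apply Real.sqrt_le_iff.mpr
  refine ⟨add_nonneg (B.fnorm_nonneg F x) (B.fnorm_nonneg F y), ?_⟩
  rw [B.fip_add_left, B.fip_add_right, B.fip_add_right]
  have h1 := B.norm_fip_le F x y
  have h2 := B.norm_fip_le F y x
  have h3 := norm_add_le (B.fip F x x + B.fip F x y) (B.fip F y x + B.fip F y y)
  have h4 := norm_add_le (B.fip F x x) (B.fip F x y)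
  have h5 := norm_add_le (B.fip F y x) (B.fip F y y)
  have h6 := B.fnorm_sq F x
  have h7 := B.fnorm_sq F y
  change _ ≤ B.fnorm F x * B.fnorm F y at h1
  change _ ≤ B.fnorm F y * B.fnorm F x at h2
  nlinarith

theorem fip_mono {F F' : Finset G} (h : F ⊆ F') (x : ∀ t, B.fiber t) :
    B.fip F x x ≤ B.fip F' x x :=
  Finset.sum_le_sum_of_subset_of_nonneg h fun t _ _ => B.ip_self_nonneg (x t)

theorem fnorm_mono {F F' : Finset G} (h : F ⊆ F') (x : ∀ t, B.fiber t) :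
    B.fnorm F x ≤ B.fnorm F' x :=
  Real.sqrt_le_sqrt
    (CStarAlgebra.norm_le_norm_of_nonneg_of_le (B.fip_self_nonneg F x) (B.fip_mono h x))

end FellBundle

namespace FellBundle
variable {G : Type u} [Group G] (B : FellBundle.{u, v} G)

open Filter Topology

/-- Sections `ξ` such that `∑ ξ(t)* ξ(t)` converges (unconditionally) in `B_1`. -/
def SqSummable (x : ∀ t, B.fiber t) : Prop := Summable fun t => B.ip (x t) (x t)

variable {B}

theorem SqSummable.vanish {x : ∀ t, B.fiber t} (hx : B.SqSummable x) {ε : ℝ} (hε : 0 < ε) :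
    ∃ s : Finset G, ∀ F : Finset G, Disjoint F s → B.fnorm F x < ε := by
  obtain ⟨s, hs⟩ := summable_iff_vanishing_norm.mp hx (ε ^ 2) (by positivity)
  refine ⟨s, fun F hF => ?_⟩
  exact (Real.sqrt_lt' hε).mpr (hs F hF)

theorem sqSummable_of_vanish {x : ∀ t, B.fiber t}
    (h : ∀ ε : ℝ, 0 < ε → ∃ s : Finset G, ∀ F : Finset G, Disjoint F s → B.fnorm F x < ε) :
    B.SqSummable x := by
  refine summable_iff_vanishing_norm.mpr fun ε hε => ?_
  obtain ⟨s, hs⟩ := h (√ε) (Real.sqrt_pos.mpr hε)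
  refine ⟨s, fun F hF => ?_⟩
  exact (Real.sqrt_lt_sqrt_iff (norm_nonneg _)).mp (hs F hF)

theorem SqSummable.summable_ip {x y : ∀ t, B.fiber t} (hx : B.SqSummable x)
    (hy : B.SqSummable y) : Summable fun t => B.ip (x t) (y t) := by
  refine summable_iff_vanishing_norm.mpr fun ε hε => ?_
  classical
  obtain ⟨s, hs⟩ := hx.vanish (Real.sqrt_pos.mpr hε)
  obtain ⟨s', hs'⟩ := hy.vanish (Real.sqrt_pos.mpr hε)
  refine ⟨s ∪ s', fun F hF => ?_⟩
  rw [Finset.disjoint_union_right] at hF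
  calc ‖∑ t ∈ F, B.ip (x t) (y t)‖ ≤ B.fnorm F x * B.fnorm F y := B.norm_fip_le F x y
    _ < √ε * √ε := mul_lt_mul'' (hs F hF.1) (hs' F hF.2) (B.fnorm_nonneg _ _) (B.fnorm_nonneg _ _)
    _ = ε := Real.mul_self_sqrt hε.le

theorem SqSummable.add {x y : ∀ t, B.fiber t} (hx : B.SqSummable x)
    (hy : B.SqSummable y) : B.SqSummable (x + y) := by
  have := ((hx.summable_ip hx).add (hx.summable_ip hy)).add
    ((hy.summable_ip hx).add (hy.summable_ip hy))
  refine this.congr fun t => ?_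
  simp only [Pi.add_apply, B.ip_add_left, B.ip_add_right]

variable (B)

/-- The vector space of square-summable sections. -/
def l2Submodule : Submodule ℂ (∀ t, B.fiber t) where
  carrier := {x | B.SqSummable x}
  add_mem' hx hy := SqSummable.add hx hy
  zero_mem' := by
    have : (fun t => B.ip ((0 : ∀ t, B.fiber t) t) ((0 : ∀ t, B.fiber t) t)) = fun _ => 0 := by
      funext t; exact B.ip_zero_left _
    change Summable _
    rw [this]
    exact summable_zero
  smul_mem' c x hx := by
    have : Summable fun t => (starRingEnd ℂ c * c) • B.ip (x t) (x t) := Summable.const_smul _ hx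
    refine this.congr fun t => ?_
    simp only [Pi.smul_apply, B.ip_smul_left, B.ip_smul_right, smul_smul]

/-- `ℓ²(B)`: the right Hilbert `B_1`-module of the sections `ξ` of `B` for which
`∑ ξ(t)* ξ(t)` converges in `B_1`, the direct sum of the Hilbert modules `B_t`. -/
def L2 : Type (max u v) := B.l2Submodule

namespace L2

variable {B}

instance : AddCommGroup B.L2 := inferInstanceAs (AddCommGroup B.l2Submodule)
instance : Module ℂ B.L2 := inferInstanceAs (Module ℂ B.l2Submodule)

/-- The section underlying an element of `ℓ²(B)`. -/
def toFun (x : B.L2) : ∀ t, B.fiber t := Subtype.val x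

instance : CoeFun B.L2 (fun _ => ∀ t, B.fiber t) := ⟨toFun⟩

/-- The element of `ℓ²(B)` given by a square-summable section. -/
def mk (x : ∀ t, B.fiber t) (hx : B.SqSummable x) : B.L2 := ⟨x, hx⟩

@[simp] theorem mk_apply (x : ∀ t, B.fiber t) (hx : B.SqSummable x) (t : G) : mk x hx t = x t := rfl

@[ext] theorem ext {x y : B.L2} (h : ∀ t, x t = y t) : x = y := Subtype.ext (funext h)

theorem sq (x : B.L2) : B.SqSummable x := x.2

@[simp] theorem add_apply (x y : B.L2) (t : G) : (x + y) t = x t + y t := rfl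
@[simp] theorem sub_apply (x y : B.L2) (t : G) : (x - y) t = x t - y t := rfl
@[simp] theorem neg_apply (x : B.L2) (t : G) : (-x) t = - x t := rfl
@[simp] theorem zero_apply (t : G) : (0 : B.L2) t = 0 := rfl
@[simp] theorem smul_apply (c : ℂ) (x : B.L2) (t : G) : (c • x) t = c • x t := rfl

/-- The `B_1`-valued inner product `⟨ξ, η⟩ = ∑ ξ(t)* η(t)` of `ℓ²(B)`. -/
noncomputable def inner (x y : B.L2) : B.fiber 1 := ∑' t, B.ip (x t) (y t)

theorem hasSum_inner (x y : B.L2) : HasSum (fun t => B.ip (x t) (y t)) (inner x y) :=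
  (x.sq.summable_ip y.sq).hasSum

theorem tendsto_fip (x y : B.L2) : Tendsto (fun F => B.fip F x y) atTop (𝓝 (inner x y)) :=
  hasSum_inner x y

theorem inner_add_right (x y z : B.L2) : inner x (y + z) = inner x y + inner x z := by
  refine HasSum.unique (hasSum_inner _ _) ?_
  refine ((hasSum_inner x y).add (hasSum_inner x z)).congr_fun ?_ 
  intro t
  simp [B.ip_add_right]

theorem inner_smul_right (c : ℂ) (x y : B.L2) : inner x (c • y) = c • inner x y := by
  refine HasSum.unique (hasSum_inner _ _) ?_
  refine ((hasSum_inner x y).const_smul c).congr_fun ?_ 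
  intro t
  simp [B.ip_smul_right]

theorem star_inner (x y : B.L2) : star (inner x y) = inner y x := by
  refine HasSum.unique ((hasSum_inner x y).star) ?_
  simpa only [B.star_ip] using hasSum_inner y x

theorem inner_add_left (x y z : B.L2) : inner (x + y) z = inner x z + inner y z := by
  rw [← star_inner, inner_add_right, star_add, star_inner, star_inner]

theorem inner_smul_left (c : ℂ) (x y : B.L2) : inner (c • x) y = (starRingEnd ℂ c) • inner x y := by
  rw [← star_inner, inner_smul_right, star_smul, star_inner]; rfl

theorem inner_self_nonneg (x : B.L2) : 0 ≤ inner x x :=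
  (hasSum_inner x x).nonneg fun _ => B.ip_self_nonneg _

noncomputable instance : Norm B.L2 := ⟨fun x => √‖inner x x‖⟩

theorem norm_def (x : B.L2) : ‖x‖ = √‖inner x x‖ := rfl

theorem norm_sq (x : B.L2) : ‖x‖ ^ 2 = ‖inner x x‖ := Real.sq_sqrt (norm_nonneg _)

theorem tendsto_fnorm (x : B.L2) : Tendsto (fun F => B.fnorm F x) atTop (𝓝 ‖x‖) :=
  (Real.continuous_sqrt.tendsto _).comp (tendsto_fip x x).norm

theorem fnorm_le (x : B.L2) (F : Finset G) : B.fnorm F x ≤ ‖x‖ := by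
  refine ge_of_tendsto (tendsto_fnorm x) ?_
  filter_upwards [eventually_ge_atTop F] with F' hF'
  exact B.fnorm_mono hF' x

theorem norm_le_of_fnorm_le (x : B.L2) {C : ℝ} (h : ∀ F, B.fnorm F x ≤ C) : ‖x‖ ≤ C :=
  le_of_tendsto' (tendsto_fnorm x) h

theorem norm_inner_le' (x y : B.L2) : ‖inner x y‖ ≤ ‖x‖ * ‖y‖ :=
  le_of_tendsto_of_tendsto' (tendsto_fip x y).norm ((tendsto_fnorm x).mul (tendsto_fnorm y))
    fun F => B.norm_fip_le F x y

theorem norm_apply_le' (x : B.L2) (t : G) : ‖x t‖ ≤ ‖x‖ := by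
  have h := fnorm_le x {t}
  have h2 := B.fnorm_sq {t} x
  rw [fip, Finset.sum_singleton, B.norm_ip_self] at h2
  rwa [(sq_eq_sq₀ (B.fnorm_nonneg _ _) (norm_nonneg _)).mp h2] at h

theorem normCore : NormedSpace.Core ℂ B.L2 where
  norm_nonneg x := Real.sqrt_nonneg _
  norm_smul c x := by
    rw [norm_def, norm_def, inner_smul_left, inner_smul_right, smul_smul, norm_smul, norm_mul,
      RCLike.norm_conj, Real.sqrt_mul (by positivity), Real.sqrt_mul_self (norm_nonneg _)]
  norm_triangle x y := norm_le_of_fnorm_le _ fun F =>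
    (B.fnorm_add_le F x y).trans (add_le_add (fnorm_le x F) (fnorm_le y F))
  norm_eq_zero_iff x := by
    constructor
    · intro h
      ext t
      have := norm_apply_le' x t
      rw [h] at this
      simpa using this
    · rintro rfl
      have : inner (0 : B.L2) 0 = 0 := by
        simpa using inner_smul_right (0 : ℂ) (0 : B.L2) 0
      rw [norm_def, this, norm_zero, Real.sqrt_zero]

noncomputable instance : NormedAddCommGroup B.L2 := NormedAddCommGroup.ofCore normCore
noncomputable instance : NormedSpace ℂ B.L2 := NormedSpace.ofCore normCore

/-- Evaluation at `t`. -/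
noncomputable def eval (t : G) : B.L2 →L[ℂ] B.fiber t :=
  LinearMap.mkContinuous
    { toFun := fun x => x t, map_add' := fun _ _ => rfl, map_smul' := fun _ _ => rfl } 1
    fun x => by rw [one_mul]; exact norm_apply_le' x t

@[simp] theorem eval_apply (t : G) (x : B.L2) : eval t x = x t := rfl

instance : CompleteSpace B.L2 := by
  refine Metric.complete_of_cauchySeq_tendsto fun x hx => ?_
  have hc : ∀ t, ∃ a, Tendsto (fun n => x n t) atTop (𝓝 a) := fun t =>
    cauchySeq_tendsto_of_complete (hx.map (eval t).uniformContinuous)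
  choose y hy using hc
  have key : ∀ ε : ℝ, 0 < ε → ∃ N, ∀ n ≥ N, ∀ F, B.fnorm F (fun t => x n t - y t) ≤ ε := by
    intro ε hε
    obtain ⟨N, hN⟩ := Metric.cauchySeq_iff.mp hx ε hε
    refine ⟨N, fun n hn F => ?_⟩
    have hcont : Tendsto (fun m => B.fnorm F (fun t => x n t - x m t)) atTop
        (𝓝 (B.fnorm F (fun t => x n t - y t))) := by
      refine (Real.continuous_sqrt.tendsto _).comp (Tendsto.norm ?_)
      refine tendsto_finsetSum _ fun t _ => ?_
      have h1 : Tendsto (fun m => x n t - x m t) atTop (𝓝 (x n t - y t)) :=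
        tendsto_const_nhds.sub (hy t)
      have h2 : Continuous fun a : B.fiber t => B.ip a a := by
        have h3 : Continuous fun a : B.fiber t => B.adj rfl a :=
          (AddMonoidHomClass.isometry_of_norm
            (AddMonoidHom.mk' (fun a : B.fiber t => B.adj rfl a) (B.adj_add' rfl))
            (B.norm_adj' rfl)).continuous
        have h4 : Continuous fun p : B.fiber t⁻¹ × B.fiber t =>
            B.mul (inv_mul_cancel t) p.1 p.2 :=
          ((B.mulL (inv_mul_cancel t)).mkContinuous₂ 1 fun a b => by
            rw [one_mul]; exact B.norm_mul_le' _ _ _).continuous₂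
        exact h4.comp (h3.prodMk continuous_id)
      exact (h2.tendsto _).comp h1
    refine le_of_tendsto hcont ?_
    filter_upwards [eventually_ge_atTop N] with m hm
    have := hN n hn m hm
    rw [dist_eq_norm] at this
    exact (fnorm_le (x n - x m) F).trans this.le
  have hysq : B.SqSummable y := by
    refine sqSummable_of_vanish fun ε hε => ?_
    obtain ⟨N, hN⟩ := key (ε / 2) (by positivity)
    obtain ⟨s, hs⟩ := (x N).sq.vanish (half_pos hε)
    refine ⟨s, fun F hF => ?_⟩
    have h1 := hN N le_rfl F
    have h2 := hs F hF
    have h3 : B.fnorm F y ≤ B.fnorm F (x N) + B.fnorm F (fun t => x N t - y t) := by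
      have h4 : B.fnorm F (fun t => x N t - y t) = B.fnorm F (fun t => y t - x N t) := by
        rw [fnorm, fnorm, fip, fip]
        congr 3
        funext t
        rw [← neg_sub (y t) (x N t), ← neg_one_smul ℝ, B.ip_real_smul_left,
          B.ip_real_smul_right, smul_smul]
        norm_num
      rw [h4]
      convert B.fnorm_add_le F (x N) (fun t => y t - x N t) using 2
      funext t
      simp
    linarith
  refine ⟨mk y hysq, ?_⟩
  rw [Metric.tendsto_atTop]
  intro ε hε
  obtain ⟨N, hN⟩ := key (ε / 2) (by positivity)
  refine ⟨N, fun n hn => ?_⟩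
  rw [dist_eq_norm]
  exact (norm_le_of_fnorm_le (x n - mk y hysq) (hN n hn)).trans_lt (by linarith)

end L2

end FellBundle

namespace FellBundle
variable {G : Type u} [Group G] (B : FellBundle.{u, v} G)

open Filter Topology

/-! ### Adjointable operators -/

variable {B} in
/-- `S` is the adjoint of `T` with respect to the `B_1`-valued inner product. -/
def IsAdj (T S : B.L2 →L[ℂ] B.L2) : Prop := ∀ x y, L2.inner (T x) y = L2.inner x (S y)

theorem L2.ext_inner {x y : B.L2} (h : ∀ z, L2.inner z x = L2.inner z y) : x = y := by
  rw [← sub_eq_zero, ← norm_eq_zero, L2.norm_def]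
  have : L2.inner (x - y) (x - y) = 0 := by
    have h1 := h (x - y)
    have h2 := L2.inner_add_right (x - y) (x - y) y
    rw [sub_add_cancel, h1] at h2
    simpa using h2
  rw [this, norm_zero, Real.sqrt_zero]

namespace IsAdj
variable {B} {T S T' S' : B.L2 →L[ℂ] B.L2}

theorem symm (h : IsAdj T S) : IsAdj S T := fun x y => by
  rw [← L2.star_inner, ← h, L2.star_inner]

theorem unique (h : IsAdj T S) (h' : IsAdj T S') : S = S' := by
  ext1 x
  exact L2.ext_inner B fun z => by rw [← h, ← h']

theorem norm_le (h : IsAdj T S) : ‖T‖ ^ 2 ≤ ‖S * T‖ := by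
  have : ‖T‖ ≤ √‖S * T‖ := by
    refine T.opNorm_le_bound (Real.sqrt_nonneg _) fun x => ?_
    refine le_of_sq_le_sq ?_ (by positivity)
    rw [L2.norm_sq, h, mul_pow, Real.sq_sqrt (norm_nonneg _)]
    calc ‖L2.inner x (S (T x))‖ ≤ ‖x‖ * ‖S (T x)‖ := L2.norm_inner_le' _ _
      _ ≤ ‖x‖ * (‖S * T‖ * ‖x‖) := by
          gcongr
          exact (S * T).le_opNorm x
      _ = _ := by ring
  calc ‖T‖ ^ 2 ≤ √‖S * T‖ ^ 2 := by gcongr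
    _ = _ := Real.sq_sqrt (norm_nonneg _)

theorem norm_le_norm (h : IsAdj T S) : ‖T‖ ≤ ‖S‖ := by
  have h1 := h.norm_le.trans (norm_mul_le S T)
  rcases eq_or_lt_of_le (norm_nonneg T) with h0 | h0
  · rw [← h0]; exact norm_nonneg S
  · rw [pow_two] at h1; exact le_of_mul_le_mul_right h1 h0

theorem norm_eq (h : IsAdj T S) : ‖T‖ = ‖S‖ := le_antisymm h.norm_le_norm h.symm.norm_le_norm

theorem one : IsAdj (1 : B.L2 →L[ℂ] B.L2) 1 := fun _ _ => rfl

theorem mul (h : IsAdj T S) (h' : IsAdj T' S') : IsAdj (T * T') (S' * S) := fun x y => by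
  change L2.inner (T (T' x)) y = L2.inner x (S' (S y))
  rw [h, h']

theorem add (h : IsAdj T S) (h' : IsAdj T' S') : IsAdj (T + T') (S + S') := fun x y => by
  change L2.inner (T x + T' x) y = L2.inner x (S y + S' y)
  rw [L2.inner_add_left, L2.inner_add_right, h, h']

theorem smul (c : ℂ) (h : IsAdj T S) : IsAdj (c • T) ((starRingEnd ℂ c) • S) := fun x y => by
  change L2.inner (c • T x) y = L2.inner x ((starRingEnd ℂ c) • S y)
  rw [L2.inner_smul_left, L2.inner_smul_right, h]

theorem neg (h : IsAdj T S) : IsAdj (-T) (-S) := by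
  simpa using h.smul (-1)

theorem sub (h : IsAdj T S) (h' : IsAdj T' S') : IsAdj (T - T') (S - S') := by
  simpa [sub_eq_add_neg] using h.add h'.neg

end IsAdj

/-- The algebra of adjointable operators on `ℓ²(B)`, as a subalgebra of the bounded operators. -/
noncomputable def adjointable : Subalgebra ℂ (B.L2 →L[ℂ] B.L2) where
  carrier := {T | ∃ S, IsAdj T S}
  mul_mem' := fun ⟨_, h⟩ ⟨_, h'⟩ => ⟨_, h.mul h'⟩
  add_mem' := fun ⟨_, h⟩ ⟨_, h'⟩ => ⟨_, h.add h'⟩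
  algebraMap_mem' c := ⟨(starRingEnd ℂ c) • 1, by
    rw [Algebra.algebraMap_eq_smul_one]; exact IsAdj.one.smul c⟩

/-- The C*-algebra `𝓛(ℓ²(B))` of adjointable operators on `ℓ²(B)`. -/
abbrev Adjointable : Type (max u v) := B.adjointable

namespace Adjointable
variable {B}

noncomputable instance : Star B.Adjointable :=
  ⟨fun T => ⟨T.2.choose, T.1, T.2.choose_spec.symm⟩⟩

theorem isAdj (T : B.Adjointable) : IsAdj T.1 (star T).1 := T.2.choose_spec

theorem star_eq {T S : B.Adjointable} (h : IsAdj T.1 S.1) : star T = S :=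
  Subtype.ext ((isAdj T).unique h)

noncomputable instance : StarRing B.Adjointable where
  star_involutive T := star_eq (isAdj T).symm
  star_mul T S := star_eq ((isAdj T).mul (isAdj S))
  star_add T S := star_eq ((isAdj T).add (isAdj S))

instance : StarModule ℂ B.Adjointable where
  star_smul c T := star_eq ((isAdj T).smul c)

instance : CompleteSpace B.Adjointable := by
  refine Metric.complete_of_cauchySeq_tendsto fun T hT => ?_
  have hT1 : CauchySeq fun n => (T n).1 := hT.map (uniformContinuous_subtype_val)
  have hT2 : CauchySeq fun n => (star (T n)).1 := by
    rw [Metric.cauchySeq_iff] at hT1 ⊢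
    intro ε hε
    obtain ⟨N, hN⟩ := hT1 ε hε
    refine ⟨N, fun m hm n hn => ?_⟩
    have := hN m hm n hn
    rw [dist_eq_norm] at this ⊢
    rwa [← ((isAdj (T m)).sub (isAdj (T n))).norm_eq]
  obtain ⟨a, ha⟩ := cauchySeq_tendsto_of_complete hT1
  obtain ⟨b, hb⟩ := cauchySeq_tendsto_of_complete hT2
  have hcont : ∀ z : B.L2, Continuous (L2.inner z) := fun z => by
    let f : B.L2 →ₗ[ℂ] B.fiber 1 :=
      { toFun := L2.inner z, map_add' := L2.inner_add_right z,
        map_smul' := fun c y => L2.inner_smul_right c z y }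
    exact (f.mkContinuous ‖z‖ (L2.norm_inner_le' z)).continuous
  have hab : IsAdj a b := by
    intro x y
    have h1 : Tendsto (fun n => L2.inner ((T n).1 x) y) atTop (𝓝 (L2.inner (a x) y)) := by
      have : Tendsto (fun n => (T n).1 x) atTop (𝓝 (a x)) :=
        ((ContinuousLinearMap.apply ℂ B.L2 x).continuous.tendsto a).comp ha
      have h2 := (((hcont y).tendsto _).comp this).star
      simpa only [Function.comp_def, L2.star_inner] using h2
    have h2 : Tendsto (fun n => L2.inner x ((star (T n)).1 y)) atTop (𝓝 (L2.inner x (b y))) := by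
      have : Tendsto (fun n => (star (T n)).1 y) atTop (𝓝 (b y)) :=
        ((ContinuousLinearMap.apply ℂ B.L2 y).continuous.tendsto b).comp hb
      exact ((hcont x).tendsto _).comp this
    refine tendsto_nhds_unique h1 (h2.congr fun n => ?_)
    exact (isAdj (T n) x y).symm
  exact ⟨⟨a, b, hab⟩, tendsto_subtype_rng.mpr ha⟩

noncomputable instance : CStarAlgebra B.Adjointable where
  norm_mul_self_le T := by
    have := (isAdj T).norm_le
    rw [pow_two] at this
    exact this

end Adjointable

/-! ### The regular representation -/

theorem fnorm_lam_le {t : G} (b : B.fiber t) (x : ∀ s, B.fiber s) (F : Finset G) :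
    B.fnorm F (fun s => B.mul (mul_inv_cancel_left t s) b (x (t⁻¹ * s))) ≤
      ‖b‖ * B.fnorm (F.map (Equiv.mulLeft t⁻¹).toEmbedding) x := by
  have h1 : B.fip F (fun s => B.mul (mul_inv_cancel_left t s) b (x (t⁻¹ * s)))
      (fun s => B.mul (mul_inv_cancel_left t s) b (x (t⁻¹ * s))) ≤
      ‖b‖ ^ 2 • B.fip (F.map (Equiv.mulLeft t⁻¹).toEmbedding) x x := by
    rw [fip, fip, Finset.sum_map, Finset.smul_sum]
    exact Finset.sum_le_sum fun s _ => B.ip_mul_mul_le _ _ _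
  have h2 := CStarAlgebra.norm_le_norm_of_nonneg_of_le (B.fip_self_nonneg F _) h1
  rw [norm_smul] at h2
  refine Real.sqrt_le_iff.mpr ⟨mul_nonneg (norm_nonneg _) (B.fnorm_nonneg _ _), ?_⟩
  rw [mul_pow, B.fnorm_sq]
  simpa using h2

theorem sqSummable_lam {t : G} (b : B.fiber t) {x : ∀ s, B.fiber s} (hx : B.SqSummable x) :
    B.SqSummable fun s => B.mul (mul_inv_cancel_left t s) b (x (t⁻¹ * s)) := by
  refine sqSummable_of_vanish fun ε hε => ?_
  obtain ⟨s, hs⟩ := hx.vanish (show 0 < ε / (‖b‖ + 1) by positivity)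
  refine ⟨s.map (Equiv.mulLeft t).toEmbedding, fun F hF => ?_⟩
  refine (B.fnorm_lam_le b x F).trans_lt ?_
  have h1 : Disjoint (F.map (Equiv.mulLeft t⁻¹).toEmbedding) s := by
    rw [Finset.disjoint_left] at hF ⊢
    intro a ha has
    obtain ⟨c, hc, rfl⟩ := Finset.mem_map.mp ha
    exact hF hc (Finset.mem_map.mpr ⟨_, has, by simp⟩)
  have h2 := hs _ h1
  have h3 := B.fnorm_nonneg (F.map (Equiv.mulLeft t⁻¹).toEmbedding) x
  rw [lt_div_iff₀ (by positivity)] at h2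
  nlinarith

/-- The operator `Λ_b` on `ℓ²(B)`, `(Λ_b ξ)(s) = b ξ(t⁻¹ s)` for `b ∈ B_t`, as a bounded
operator. -/
noncomputable def lamCLM {t : G} (b : B.fiber t) : B.L2 →L[ℂ] B.L2 :=
  LinearMap.mkContinuous
    { toFun := fun x => L2.mk (fun s => B.mul (mul_inv_cancel_left t s) b (x (t⁻¹ * s)))
        (B.sqSummable_lam b x.sq)
      map_add' := fun _ _ => L2.ext fun _ => B.mul_add' _ _ _ _
      map_smul' := fun _ _ => L2.ext fun _ => B.mul_smul' _ _ _ _ } ‖b‖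
    fun x => L2.norm_le_of_fnorm_le _ fun F => (B.fnorm_lam_le b x F).trans
      (mul_le_mul_of_nonneg_left (L2.fnorm_le x _) (norm_nonneg b))

@[simp] theorem lamCLM_apply {t : G} (b : B.fiber t) (x : B.L2) (s : G) :
    B.lamCLM b x s = B.mul (mul_inv_cancel_left t s) b (x (t⁻¹ * s)) := rfl

theorem isAdj_lamCLM {t t' : G} (h : t⁻¹ = t') (b : B.fiber t) :
    IsAdj (B.lamCLM b) (B.lamCLM (B.adj h b)) := by
  subst h
  intro x y
  rw [L2.inner, L2.inner, ← (Equiv.mulLeft t).tsum_eq]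
  refine tsum_congr fun s => ?_
  simp only [lamCLM_apply, Equiv.coe_mulLeft]
  rw [B.ip_adj _ (by simp)]
  have e1 : t⁻¹ * (t * s) = s := by simp
  have e2 : t * s = t⁻¹⁻¹ * s := by simp
  have : ∀ (r q : G) (_ : r = s) (_ : t * s = q) (h : t⁻¹ * (t * s) = r) (h' : t⁻¹ * q = s),
      B.ip (x r) (B.mul h (B.adj rfl b) (y (t * s))) =
      B.ip (x s) (B.mul h' (B.adj rfl b) (y q)) := by
    rintro r q rfl rfl h h'
    rfl
  exact this _ _ e1 e2 _ _

/-- The regular representation `b ↦ Λ_b`, with values in the adjointable operators on `ℓ²(B)`. -/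
noncomputable def lam {t : G} (b : B.fiber t) : B.Adjointable :=
  ⟨B.lamCLM b, _, B.isAdj_lamCLM rfl b⟩

theorem lamCLM_mul {s t r : G} (h : s * t = r) (a : B.fiber s) (b : B.fiber t) :
    B.lamCLM (B.mul h a b) = B.lamCLM a * B.lamCLM b := by
  subst h
  ext x g
  change B.mul _ (B.mul rfl a b) (x ((s * t)⁻¹ * g)) =
    B.mul _ a (B.mul _ b (x (t⁻¹ * (s⁻¹ * g))))
  rw [B.mul_assoc' _ _ (show t * ((s * t)⁻¹ * g) = s⁻¹ * g by group) (by simp)]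
  congr 1
  have e : (s * t)⁻¹ * g = t⁻¹ * (s⁻¹ * g) := by group
  generalize_proofs p q
  revert p q
  rw [e]
  intros; rfl

theorem lam_mul {s t r : G} (h : s * t = r) (a : B.fiber s) (b : B.fiber t) :
    B.lam (B.mul h a b) = B.lam a * B.lam b := Subtype.ext (B.lamCLM_mul h a b)

theorem star_lam {t t' : G} (h : t⁻¹ = t') (b : B.fiber t) :
    star (B.lam b) = B.lam (B.adj h b) := Adjointable.star_eq (B.isAdj_lamCLM h b)

theorem lam_add {t : G} (a b : B.fiber t) : B.lam (a + b) = B.lam a + B.lam b :=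
  Subtype.ext (ContinuousLinearMap.ext fun _ => L2.ext fun _ => B.add_mul' _ _ _ _)

theorem lam_smul {t : G} (c : ℂ) (b : B.fiber t) : B.lam (c • b) = c • B.lam b :=
  Subtype.ext (ContinuousLinearMap.ext fun _ => L2.ext fun _ => B.smul_mul' _ _ _ _)

/-! ### The reduced cross-sectional algebra -/

/-- The C*-subalgebra of `𝓛(ℓ²(B))` generated by the operators `Λ_b`, `b ∈ B`. -/
noncomputable def reducedSubalgebra : NonUnitalStarSubalgebra ℂ B.Adjointable :=
  (NonUnitalStarAlgebra.adjoin ℂ {T | ∃ (t : G) (b : B.fiber t), T = B.lam b}).topologicalClosure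

instance isClosed_reducedSubalgebra : IsClosed (B.reducedSubalgebra : Set B.Adjointable) :=
  NonUnitalStarSubalgebra.isClosed_topologicalClosure _

/-- The reduced cross-sectional C*-algebra `C*_r(B)`. -/
def Reduced : Type (max u v) := B.reducedSubalgebra

noncomputable instance : NonUnitalCStarAlgebra B.Reduced :=
  inferInstanceAs (NonUnitalCStarAlgebra B.reducedSubalgebra)

/-- The canonical map `b ↦ Λ_b` from `B_t` to `C*_r(B)`. -/
noncomputable def toReduced (t : G) : B.fiber t →ₗ[ℂ] B.Reduced where
  toFun b := ⟨B.lam b, NonUnitalStarSubalgebra.le_topologicalClosure _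
    (NonUnitalStarAlgebra.subset_adjoin ℂ _ ⟨t, b, rfl⟩)⟩
  map_add' a b := Subtype.ext (B.lam_add a b)
  map_smul' c b := Subtype.ext (B.lam_smul c b)

/-- The inclusion of `C*_r(B)` in `𝓛(ℓ²(B))`. -/
def Reduced.val (x : B.Reduced) : B.Adjointable := Subtype.val x

/-- The operator on `ℓ²(B)` given by an element of `C*_r(B)`. -/
noncomputable def Reduced.op : B.Reduced →L[ℂ] (B.L2 →L[ℂ] B.L2) :=
  LinearMap.mkContinuous
    { toFun := fun x => (Reduced.val B x).1
      map_add' := fun _ _ => rfl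
      map_smul' := fun _ _ => rfl } 1
    fun x => by rw [one_mul]; exact le_refl ‖x‖

theorem Reduced.norm_op (x : B.Reduced) : ‖Reduced.op B x‖ = ‖x‖ := rfl

theorem op_toReduced {t : G} (b : B.fiber t) : Reduced.op B (B.toReduced t b) = B.lamCLM b := rfl

theorem Reduced.op_mul (x y : B.Reduced) :
    Reduced.op B (x * y) = Reduced.op B x * Reduced.op B y := rfl

theorem Reduced.isAdj_op (x : B.Reduced) : IsAdj (Reduced.op B x) (Reduced.op B (star x)) :=
  Adjointable.isAdj x.1

theorem toReduced_mul {s t r : G} (h : s * t = r) (a : B.fiber s) (b : B.fiber t) :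
    B.toReduced r (B.mul h a b) = B.toReduced s a * B.toReduced t b := Subtype.ext (B.lam_mul h a b)

theorem star_toReduced {t t' : G} (h : t⁻¹ = t') (b : B.fiber t) :
    star (B.toReduced t b) = B.toReduced t' (B.adj h b) := Subtype.ext (B.star_lam h b)

/-- The image in `C*_r(B)` of the finitely supported sections. -/
noncomputable def finSupp : Submodule ℂ B.Reduced := ⨆ t, LinearMap.range (B.toReduced t)

theorem toReduced_mem_finSupp {t : G} (b : B.fiber t) : B.toReduced t b ∈ B.finSupp :=
  Submodule.mem_iSup_of_mem t ⟨b, rfl⟩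

variable {B} in
theorem finSupp_induction (p : B.Reduced → Prop) (h0 : p 0) (hadd : ∀ x y, p x → p y → p (x + y))
    (h : ∀ t (b : B.fiber t), p (B.toReduced t b)) {x : B.Reduced} (hx : x ∈ B.finSupp) : p x := by
  refine Submodule.iSup_induction (motive := p) _ hx ?_ h0 hadd
  rintro t _ ⟨b, rfl⟩
  exact h t b

theorem mul_mem_finSupp {x y : B.Reduced} (hx : x ∈ B.finSupp) (hy : y ∈ B.finSupp) :
    x * y ∈ B.finSupp := by
  refine finSupp_induction (fun x => x * y ∈ B.finSupp) (by simp)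
    (fun a b ha hb => by rw [add_mul]; exact add_mem ha hb) (fun t a => ?_) hx
  refine finSupp_induction (fun y => B.toReduced t a * y ∈ B.finSupp) (by simp)
    (fun a b ha hb => by rw [mul_add]; exact add_mem ha hb) (fun s b => ?_) hy
  rw [← B.toReduced_mul rfl]; exact B.toReduced_mem_finSupp _

theorem star_mem_finSupp {x : B.Reduced} (hx : x ∈ B.finSupp) : star x ∈ B.finSupp := by
  refine finSupp_induction (fun x => star x ∈ B.finSupp) (by simp)
    (fun a b ha hb => by rw [star_add]; exact add_mem ha hb) (fun t a => ?_) hx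
  rw [B.star_toReduced rfl]; exact B.toReduced_mem_finSupp _

theorem Reduced.isometry_val : Isometry (Reduced.val B) := Isometry.of_dist_eq fun _ _ => rfl

theorem dense_finSupp : Dense (B.finSupp : Set B.Reduced) := by
  intro x
  have h1 : (NonUnitalStarAlgebra.adjoin ℂ
      {T | ∃ (t : G) (b : B.fiber t), T = B.lam b} : Set B.Adjointable) ⊆
      Reduced.val B '' (B.finSupp : Set B.Reduced) := by
    intro T hT
    induction hT using NonUnitalStarAlgebra.adjoin_induction with
    | mem T hT => obtain ⟨t, b, rfl⟩ := hT; exact ⟨_, B.toReduced_mem_finSupp b, rfl⟩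
    | zero => exact ⟨0, zero_mem _, rfl⟩
    | add _ _ _ _ h h' =>
      obtain ⟨a, ha, rfl⟩ := h; obtain ⟨b, hb, rfl⟩ := h'
      exact ⟨a + b, add_mem ha hb, rfl⟩
    | mul _ _ _ _ h h' =>
      obtain ⟨a, ha, rfl⟩ := h; obtain ⟨b, hb, rfl⟩ := h'
      exact ⟨a * b, B.mul_mem_finSupp ha hb, rfl⟩
    | smul c _ _ h =>
      obtain ⟨a, ha, rfl⟩ := h
      exact ⟨c • a, Submodule.smul_mem _ _ ha, rfl⟩
    | star _ _ h =>
      obtain ⟨a, ha, rfl⟩ := h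
      exact ⟨star a, B.star_mem_finSupp ha, rfl⟩
  have h2 : Reduced.val B x ∈ closure (Reduced.val B '' (B.finSupp : Set B.Reduced)) :=
    closure_mono h1 x.2
  rw [(Reduced.isometry_val B).isUniformInducing.isInducing.closure_eq_preimage_closure_image]
  exact h2

end FellBundle

namespace FellBundle
variable {G : Type u} [Group G] (B : FellBundle.{u, v} G)

open Filter Topology

/-! ### Sections supported at one point -/

open Classical in
/-- The section `b δ_t`. -/
noncomputable def L2.single (t : G) : B.fiber t →ₗ[ℂ] B.L2 where
  toFun b := L2.mk (Pi.single t b) <| by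
    refine summable_of_hasFiniteSupport ((Set.finite_singleton t).subset fun s hs => ?_)
    by_contra hst
    refine hs ?_
    change B.ip (Pi.single t b s) (Pi.single t b s) = 0
    rw [Pi.single_eq_of_ne hst, B.ip_zero_left]
  map_add' a b := L2.ext fun s => congrFun (Pi.single_add t a b) s
  map_smul' c b := L2.ext fun s => congrFun (Pi.single_smul t c b) s

theorem L2.single_same (t : G) (b : B.fiber t) : L2.single B t b t = b := by
  classical
  exact Pi.single_eq_same t b

theorem L2.single_ne {t s : G} (h : s ≠ t) (b : B.fiber t) : L2.single B t b s = 0 := by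
  classical
  exact Pi.single_eq_of_ne h b

theorem L2.inner_single (t : G) (b : B.fiber t) (y : B.L2) :
    L2.inner (L2.single B t b) y = B.ip b (y t) := by
  rw [L2.inner, tsum_eq_single t, L2.single_same]
  intro s hs
  rw [L2.single_ne B hs, B.ip_zero_left]

theorem L2.norm_single (t : G) (b : B.fiber t) : ‖L2.single B t b‖ = ‖b‖ := by
  rw [← sq_eq_sq₀ (norm_nonneg _) (norm_nonneg _), L2.norm_sq, L2.inner_single, L2.single_same,
    B.norm_ip_self]

theorem lamCLM_single {t s r : G} (h : t * s = r) (b : B.fiber t) (x : B.fiber s) :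
    B.lamCLM b (L2.single B s x) = L2.single B r (B.mul h b x) := by
  subst h
  ext g
  rw [lamCLM_apply]
  by_cases hg : g = t * s
  · subst hg
    rw [L2.single_same]
    have : ∀ (r : G) (h : t * r = t * s), r = s → B.mul h b (L2.single B s x r) =
        B.mul rfl b x := by
      rintro r h rfl
      rw [L2.single_same]
    exact this _ _ (by simp)
  · rw [L2.single_ne B hg, L2.single_ne B (by rwa [ne_eq, inv_mul_eq_iff_eq_mul]), B.mul_zero']

theorem L2.mem_closure_single (x : B.L2) :
    x ∈ closure ((⨆ t, LinearMap.range (L2.single B t) : Submodule ℂ B.L2) : Set B.L2) := by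
  classical
  rw [Metric.mem_closure_iff]
  intro ε hε
  obtain ⟨F, hF⟩ := x.sq.vanish (half_pos hε)
  refine ⟨∑ t ∈ F, L2.single B t (x t), Submodule.sum_mem _ fun t _ =>
    Submodule.mem_iSup_of_mem t ⟨_, rfl⟩, ?_⟩
  have hco : ∀ s, (x - ∑ t ∈ F, L2.single B t (x t)) s = if s ∈ F then 0 else x s := by
    intro s
    rw [L2.sub_apply, ← L2.eval_apply s (∑ t ∈ F, L2.single B t (x t)), map_sum]
    simp only [L2.eval_apply]
    split_ifs with hs
    · rw [Finset.sum_eq_single s (fun t _ hts => L2.single_ne B hts.symm _)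
        (fun h => absurd hs h), L2.single_same, sub_self]
    · rw [Finset.sum_eq_zero (fun t ht => L2.single_ne B (fun h : s = t => hs (h ▸ ht)) _), sub_zero]
  rw [dist_eq_norm]
  refine (L2.norm_le_of_fnorm_le _ fun F' => ?_).trans_lt (half_lt_self hε)
  have : B.fnorm F' (x - ∑ t ∈ F, L2.single B t (x t) : B.L2) = B.fnorm (F' \ F) x := by
    rw [fnorm, fnorm, fip, fip, Finset.sdiff_eq_filter, Finset.sum_filter]
    congr 2
    refine Finset.sum_congr rfl fun s _ => ?_
    rw [hco]
    by_cases hs : s ∈ F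
    · simp [hs, B.ip_zero_left]
    · simp [hs]
  rw [this]
  exact (hF _ Finset.sdiff_disjoint).le

/-! ### The conditional expectation -/

/-- The inclusion of `B_1` in `ℓ²(B)` as a bounded operator. -/
noncomputable def singleOne : B.fiber 1 →L[ℂ] B.L2 :=
  (L2.single B 1).mkContinuous 1 fun x => by rw [one_mul, L2.norm_single]

/-- The compression `c ↦ (x (c δ_1))(1)` of `x ∈ C*_r(B)` to `B_1`. -/
noncomputable def compress : B.Reduced →L[ℂ] (B.fiber 1 →L[ℂ] B.fiber 1) :=
  (ContinuousLinearMap.compL ℂ (B.fiber 1) B.L2 (B.fiber 1) (L2.eval 1)) ∘L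
    ((ContinuousLinearMap.compL ℂ (B.fiber 1) B.L2 B.L2).flip B.singleOne) ∘L Reduced.op B

theorem compress_apply (x : B.Reduced) (c : B.fiber 1) :
    B.compress x c = Reduced.op B x (L2.single B 1 c) 1 := rfl

theorem compress_toReduced_one (b : B.fiber 1) :
    B.compress (B.toReduced 1 b) = ContinuousLinearMap.mul ℂ (B.fiber 1) b := by
  ext c
  rw [compress_apply, op_toReduced, B.lamCLM_single (one_mul 1), L2.single_same]
  rfl

theorem compress_toReduced_ne {t : G} (ht : t ≠ 1) (b : B.fiber t) :
    B.compress (B.toReduced t b) = 0 := by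
  ext c
  rw [compress_apply, op_toReduced, B.lamCLM_single (mul_one t), L2.single_ne B ht.symm]
  rfl

theorem compress_mem_range (x : B.Reduced) :
    B.compress x ∈ LinearMap.range (ContinuousLinearMap.mulₗᵢ ℂ (B.fiber 1)).toLinearMap := by
  have hcl : IsClosed (Set.range (ContinuousLinearMap.mulₗᵢ ℂ (B.fiber 1))) :=
    (ContinuousLinearMap.mulₗᵢ ℂ (B.fiber 1)).isometry.isClosedEmbedding.isClosed_range
  have h1 : (B.finSupp : Set B.Reduced) ⊆
      B.compress ⁻¹' (Set.range (ContinuousLinearMap.mulₗᵢ ℂ (B.fiber 1))) := by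
    intro x hx
    refine finSupp_induction
      (fun x => B.compress x ∈ Set.range (ContinuousLinearMap.mulₗᵢ ℂ (B.fiber 1)))
      ⟨0, by simp⟩ ?_ ?_ hx
    · rintro x y ⟨a, ha⟩ ⟨b, hb⟩
      exact ⟨a + b, by rw [map_add, map_add, ha, hb]⟩
    · intro t b
      by_cases ht : t = 1
      · subst ht
        exact ⟨b, (B.compress_toReduced_one b).symm⟩
      · exact ⟨0, by rw [map_zero, B.compress_toReduced_ne ht]⟩
  exact (hcl.preimage B.compress.continuous).closure_subset_iff.mpr h1 (B.dense_finSupp x)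

/-- The canonical conditional expectation `E : C*_r(B) → B_1`, the continuous linear map that
extends the evaluation of finitely supported sections at the unit: `E(Λ_b) = b` for `b ∈ B_1` and
`E(Λ_b) = 0` for `b ∈ B_t`, `t ≠ 1`. Here `E(x)` is the element of `B_1` such that
`(x (c δ_1))(1) = E(x) c` for all `c ∈ B_1`. -/
noncomputable def condExp : B.Reduced →L[ℂ] B.fiber 1 :=
  (ContinuousLinearMap.mulₗᵢ ℂ (B.fiber 1)).equivRange.symm.toContinuousLinearEquiv.toContinuousLinearMap ∘L
    B.compress.codRestrict _ B.compress_mem_range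

theorem mul_condExp (x : B.Reduced) :
    ContinuousLinearMap.mul ℂ (B.fiber 1) (B.condExp x) = B.compress x := by
  have := (ContinuousLinearMap.mulₗᵢ ℂ (B.fiber 1)).equivRange.apply_symm_apply
    ⟨B.compress x, B.compress_mem_range x⟩
  exact congrArg Subtype.val this

theorem condExp_mul (x : B.Reduced) (c : B.fiber 1) :
    B.condExp x * c = Reduced.op B x (L2.single B 1 c) 1 :=
  congrArg (fun f => f c) (B.mul_condExp x)

theorem condExp_toReduced_one (b : B.fiber 1) : B.condExp (B.toReduced 1 b) = b := by
  apply (ContinuousLinearMap.mulₗᵢ ℂ (B.fiber 1)).injective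
  exact (B.mul_condExp _).trans (B.compress_toReduced_one b)

theorem condExp_toReduced_ne {t : G} (ht : t ≠ 1) (b : B.fiber t) :
    B.condExp (B.toReduced t b) = 0 := by
  apply (ContinuousLinearMap.mulₗᵢ ℂ (B.fiber 1)).injective
  exact (B.mul_condExp _).trans ((B.compress_toReduced_ne ht b).trans (map_zero _).symm)

theorem norm_condExp_le (x : B.Reduced) : ‖B.condExp x‖ ≤ ‖x‖ := by
  rw [← (ContinuousLinearMap.mulₗᵢ ℂ (B.fiber 1)).norm_map]
  change ‖ContinuousLinearMap.mul ℂ (B.fiber 1) (B.condExp x)‖ ≤ _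
  rw [B.mul_condExp]
  refine ContinuousLinearMap.opNorm_le_bound _ (norm_nonneg _) fun c => ?_
  rw [compress_apply]
  refine (L2.norm_apply_le' _ _).trans (((Reduced.op B x).le_opNorm _).trans_eq ?_)
  rw [L2.norm_single, Reduced.norm_op]

/-! ### Morphisms and the induced maps of reduced algebras -/

/-- A morphism of Fell bundles over `G`: a family of linear maps between the fibers that preserves
products and adjoints. -/
structure Hom (A : FellBundle.{u, v} G) (B : FellBundle.{u, w} G) where
  toLin : ∀ t, A.fiber t →ₗ[ℂ] B.fiber t
  map_mul' : ∀ {s t r : G} (h : s * t = r) (a : A.fiber s) (b : A.fiber t),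
    toLin r (A.mul h a b) = B.mul h (toLin s a) (toLin t b)
  map_adj' : ∀ {s t : G} (h : s⁻¹ = t) (a : A.fiber s),
    toLin t (A.adj h a) = B.adj h (toLin s a)

namespace Hom

variable {A : FellBundle.{u, v} G} {B : FellBundle.{u, w} G} (φ : Hom A B)

/-- The *-homomorphism between the unit fibers. -/
noncomputable def unitHom : A.fiber 1 →⋆ₙₐ[ℂ] B.fiber 1 where
  toFun := φ.toLin 1
  map_smul' c a := map_smul (φ.toLin 1) c a
  map_zero' := map_zero (φ.toLin 1)
  map_add' a b := map_add (φ.toLin 1) a b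
  map_mul' a b := φ.map_mul' _ a b
  map_star' a := φ.map_adj' _ a

theorem norm_unitHom_le (a : A.fiber 1) : ‖φ.toLin 1 a‖ ≤ ‖a‖ :=
  NonUnitalStarAlgHom.norm_apply_le φ.unitHom a

/-- The graph of `Λ_a ↦ Λ_{φ(a)}` on the images of the finitely supported sections. -/
noncomputable def rel : Submodule ℂ (A.Reduced × B.Reduced) :=
  ⨆ t, LinearMap.range ((A.toReduced t).prod (B.toReduced t ∘ₗ φ.toLin t))

theorem mem_rel {t : G} (a : A.fiber t) : (A.toReduced t a, B.toReduced t (φ.toLin t a)) ∈ φ.rel :=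
  Submodule.mem_iSup_of_mem t ⟨a, rfl⟩

theorem rel_induction (p : A.Reduced × B.Reduced → Prop) (h0 : p 0)
    (hadd : ∀ x y, p x → p y → p (x + y))
    (h : ∀ t (a : A.fiber t), p (A.toReduced t a, B.toReduced t (φ.toLin t a)))
    {x : A.Reduced × B.Reduced} (hx : x ∈ φ.rel) : p x := by
  refine Submodule.iSup_induction (motive := p) _ hx ?_ h0 hadd
  rintro t _ ⟨b, rfl⟩
  exact h t b

theorem mul_mem_rel {x y : A.Reduced × B.Reduced} (hx : x ∈ φ.rel) (hy : y ∈ φ.rel) :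
    x * y ∈ φ.rel := by
  refine φ.rel_induction (fun x => x * y ∈ φ.rel) (by simp)
    (fun a b ha hb => by rw [add_mul]; exact add_mem ha hb) (fun t a => ?_) hx
  refine φ.rel_induction
    (fun y => (A.toReduced t a, B.toReduced t (φ.toLin t a)) * y ∈ φ.rel) (by simp)
    (fun a b ha hb => by rw [mul_add]; exact add_mem ha hb) (fun s b => ?_) hy
  rw [Prod.mk_mul_mk, ← A.toReduced_mul rfl, ← B.toReduced_mul rfl, ← φ.map_mul']
  exact φ.mem_rel _

theorem star_mem_rel {x : A.Reduced × B.Reduced} (hx : x ∈ φ.rel) : star x ∈ φ.rel := by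
  refine φ.rel_induction (fun x => star x ∈ φ.rel) (by simp)
    (fun a b ha hb => by rw [star_add]; exact add_mem ha hb) (fun t a => ?_) hx
  have : star (A.toReduced t a, B.toReduced t (φ.toLin t a)) =
      (star (A.toReduced t a), star (B.toReduced t (φ.toLin t a))) := rfl
  rw [this, A.star_toReduced rfl, B.star_toReduced rfl, ← φ.map_adj']
  exact φ.mem_rel _

theorem rel_diag {x : A.Reduced × B.Reduced} (hx : x ∈ φ.rel) (s : G) (b : B.fiber s) :
    Reduced.op B x.2 (L2.single B s b) s =
      B.mul (one_mul s) (φ.toLin 1 (A.condExp x.1)) b := by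
  refine φ.rel_induction (fun x => Reduced.op B x.2 (L2.single B s b) s =
      B.mul (one_mul s) (φ.toLin 1 (A.condExp x.1)) b) ?_ ?_ ?_ hx
  · simp [B.zero_mul']
  · intro x y hx hy
    simp only [Prod.fst_add, Prod.snd_add, map_add, B.add_mul', ← hx, ← hy]
    rfl
  · intro t a
    simp only
    by_cases ht : t = 1
    · subst ht
      rw [op_toReduced, B.lamCLM_single (one_mul s), L2.single_same, A.condExp_toReduced_one]
    · rw [op_toReduced, B.lamCLM_single rfl, L2.single_ne B (by simpa using ht),
        A.condExp_toReduced_ne ht, map_zero, B.zero_mul']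

/-- The sequence `p, p², p⁴, …`. -/
def sqIter {R : Type*} [Mul R] (p : R) : ℕ → R
  | 0 => p
  | k + 1 => sqIter p k * sqIter p k

theorem bound_of_iter {r : ℕ → ℝ} {a M C : ℝ} (ha : 0 ≤ a) (hM : 0 ≤ M)
    (h1 : ∀ k, r k ^ 2 ≤ a * r (k + 1)) (h2 : ∀ k, r k ≤ C * M ^ (2 ^ k)) : r 0 ≤ M * a := by
  by_contra! hlt
  rcases eq_or_lt_of_le ha with rfl | ha
  · have := h1 0
    simp only [zero_mul, mul_zero] at this hlt
    nlinarith
  set ρ := r 0 / a with hρ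
  have hMρ : M < ρ := by rw [hρ, lt_div_iff₀ ha]; exact hlt
  have h3 : ∀ k, ρ ^ (2 ^ k) ≤ r k / a := by
    intro k
    induction k with
    | zero => simp [hρ]
    | succ k ih =>
      rw [pow_succ 2, pow_mul]
      have h4 : (ρ ^ 2 ^ k) ^ 2 ≤ (r k / a) ^ 2 := by gcongr; exact pow_nonneg (hM.trans hMρ.le) _
      refine h4.trans ?_
      rw [div_pow, div_le_div_iff₀ (by positivity) ha]
      nlinarith [h1 k]
  have h4 : ∀ k, ρ ^ (2 ^ k) ≤ C / a * M ^ (2 ^ k) := fun k => by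
    refine (h3 k).trans ?_
    rw [div_mul_eq_mul_div]
    gcongr
    exact h2 k
  rcases eq_or_lt_of_le hM with rfl | hM
  · have := h4 0
    simp at this
    linarith
  obtain ⟨n, hn⟩ := pow_unbounded_of_one_lt (C / a) ((one_lt_div hM).mpr hMρ)
  have h5 : (ρ / M) ^ n ≤ (ρ / M) ^ (2 ^ n) :=
    pow_le_pow_right₀ ((one_lt_div hM).mpr hMρ).le Nat.lt_two_pow_self.le
  have h6 := h4 n
  rw [div_pow _ _ (2 ^ n)] at h5
  have h7 : ρ ^ 2 ^ n / M ^ 2 ^ n ≤ C / a := by rw [div_le_iff₀ (by positivity)]; exact h6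
  linarith

theorem norm_snd_le_of_mem_rel {x : A.Reduced × B.Reduced} (hx : x ∈ φ.rel) : ‖x.2‖ ≤ ‖x.1‖ := by
  set p := star x * x with hp
  have hmem : ∀ k, sqIter p k ∈ φ.rel := by
    intro k
    induction k with
    | zero => exact φ.mul_mem_rel (φ.star_mem_rel hx) hx
    | succ k ih => exact φ.mul_mem_rel ih ih
  have hstar : ∀ k, star (sqIter p k) = sqIter p k := by
    intro k
    induction k with
    | zero => simp [sqIter, hp]
    | succ k ih => simp [sqIter, ih]
  have hnorm : ∀ k, ‖(sqIter p k).1‖ ≤ ‖p.1‖ ^ (2 ^ k) := by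
    intro k
    induction k with
    | zero => simp [sqIter]
    | succ k ih =>
      rw [pow_succ 2, pow_mul, pow_two]
      exact (norm_mul_le _ _).trans (mul_le_mul ih ih (norm_nonneg _) (by positivity))
  set T : ℕ → B.L2 →L[ℂ] B.L2 := fun k => Reduced.op B (sqIter p k).2 with hT
  have hadj : ∀ k, IsAdj (T k) (T k) := by
    intro k
    have := Reduced.isAdj_op B (sqIter p k).2
    have h2 : star (sqIter p k).2 = (sqIter p k).2 := congrArg Prod.snd (hstar k)
    rwa [h2] at this
  have hsq : ∀ k ξ, ‖T k ξ‖ ^ 2 = ‖L2.inner ξ (T (k + 1) ξ)‖ := by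
    intro k ξ
    rw [L2.norm_sq, hadj k]
    rfl
  have hrec : ∀ k ξ, ‖T k ξ‖ ^ 2 ≤ ‖ξ‖ * ‖T (k + 1) ξ‖ := fun k ξ => by
    rw [hsq]; exact L2.norm_inner_le' _ _
  have hbound : ∀ ξ ∈ (⨆ t, LinearMap.range (L2.single B t) : Submodule ℂ B.L2),
      ∃ C, ∀ k, ‖T k ξ‖ ≤ C * ‖p.1‖ ^ (2 ^ k) := by
    intro ξ hξ
    refine Submodule.iSup_induction (motive := fun ξ => ∃ C, ∀ k, ‖T k ξ‖ ≤ C * ‖p.1‖ ^ (2 ^ k))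
      _ hξ ?_ ⟨0, by simp⟩ ?_
    · rintro s _ ⟨b, rfl⟩
      refine ⟨‖b‖, fun k => ?_⟩
      refine le_of_sq_le_sq ?_ (by positivity)
      rw [hsq, L2.inner_single, φ.rel_diag (hmem (k + 1))]
      have h3 : ∀ y : B.fiber s, ‖B.ip b y‖ ≤ ‖b‖ * ‖y‖ := fun y =>
        (B.norm_mul_le' _ _ _).trans_eq (by rw [B.norm_adj'])
      refine (h3 _).trans ?_
      rw [mul_pow, pow_two, mul_assoc]
      gcongr
      refine (B.norm_mul_le' _ _ _).trans ?_
      rw [mul_comm ‖b‖, ← pow_mul, ← pow_succ]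
      gcongr
      exact (φ.norm_unitHom_le _).trans ((A.norm_condExp_le _).trans (hnorm _))
    · rintro ξ η ⟨C, hC⟩ ⟨D, hD⟩
      refine ⟨C + D, fun k => ?_⟩
      rw [map_add, add_mul]
      exact (norm_add_le _ _).trans (add_le_add (hC k) (hD k))
  have hp1 : ‖p.1‖ = ‖x.1‖ * ‖x.1‖ := CStarRing.norm_star_mul_self
  have hfin : ∀ ξ ∈ (⨆ t, LinearMap.range (L2.single B t) : Submodule ℂ B.L2),
      ‖Reduced.op B x.2 ξ‖ ≤ ‖x.1‖ * ‖ξ‖ := by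
    intro ξ hξ
    obtain ⟨C, hC⟩ := hbound ξ hξ
    have h4 : ‖T 0 ξ‖ ≤ ‖p.1‖ * ‖ξ‖ :=
      bound_of_iter (r := fun k => ‖T k ξ‖) (norm_nonneg _) (norm_nonneg _)
        (fun k => hrec k ξ) hC
    refine le_of_sq_le_sq ?_ (by positivity)
    have h5 : ‖Reduced.op B x.2 ξ‖ ^ 2 = ‖L2.inner ξ (T 0 ξ)‖ := by
      rw [L2.norm_sq, Reduced.isAdj_op B x.2]
      rfl
    rw [h5]
    refine (L2.norm_inner_le' _ _).trans ?_
    rw [hp1] at h4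
    nlinarith [norm_nonneg ξ]
  rw [← Reduced.norm_op B]
  refine ContinuousLinearMap.opNorm_le_bound _ (norm_nonneg _) fun ξ => ?_
  have hcl : IsClosed {ξ : B.L2 | ‖Reduced.op B x.2 ξ‖ ≤ ‖x.1‖ * ‖ξ‖} :=
    isClosed_le (Reduced.op B x.2).continuous.norm (continuous_const.mul continuous_norm)
  exact hcl.closure_subset_iff.mpr hfin (L2.mem_closure_single B ξ)

/-- The *-homomorphism `φ_r : C*_r(A) → C*_r(B)` induced by a morphism `φ : A → B` of Fell bundles:
the continuous extension of `Λ_a ↦ Λ_{φ(a)}`, as a continuous linear map. -/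
noncomputable def reduced : A.Reduced →L[ℂ] B.Reduced :=
  LinearMap.extendOfNorm (LinearMap.snd ℂ A.Reduced B.Reduced ∘ₗ φ.rel.subtype)
    (LinearMap.fst ℂ A.Reduced B.Reduced ∘ₗ φ.rel.subtype)

theorem denseRange_rel :
    DenseRange (LinearMap.fst ℂ A.Reduced B.Reduced ∘ₗ φ.rel.subtype) := by
  refine A.dense_finSupp.mono fun x hx => ?_
  refine finSupp_induction
    (fun x => x ∈ Set.range (LinearMap.fst ℂ A.Reduced B.Reduced ∘ₗ φ.rel.subtype))
    ⟨0, rfl⟩ ?_ ?_ hx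
  · rintro x y ⟨a, rfl⟩ ⟨b, rfl⟩
    exact ⟨a + b, rfl⟩
  · intro t a
    exact ⟨⟨_, φ.mem_rel a⟩, rfl⟩

theorem reduced_of_mem_rel {x : A.Reduced × B.Reduced} (hx : x ∈ φ.rel) : φ.reduced x.1 = x.2 :=
  LinearMap.extendOfNorm_eq φ.denseRange_rel
    ⟨1, fun y => by rw [one_mul]; exact φ.norm_snd_le_of_mem_rel y.2⟩ ⟨x, hx⟩

theorem reduced_toReduced {t : G} (a : A.fiber t) :
    φ.reduced (A.toReduced t a) = B.toReduced t (φ.toLin t a) := φ.reduced_of_mem_rel (φ.mem_rel a)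

theorem reduced_mul (x y : A.Reduced) : φ.reduced (x * y) = φ.reduced x * φ.reduced y := by
  have hcl : IsClosed {p : A.Reduced × A.Reduced |
      φ.reduced (p.1 * p.2) = φ.reduced p.1 * φ.reduced p.2} :=
    isClosed_eq (φ.reduced.continuous.comp continuous_mul)
      ((φ.reduced.continuous.comp continuous_fst).mul (φ.reduced.continuous.comp continuous_snd))
  have hxy : (x, y) ∈ closure (Set.range (fun z : φ.rel => z.1.1) ×ˢ
      Set.range (fun z : φ.rel => z.1.1)) := by
    rw [closure_prod_eq]
    exact ⟨φ.denseRange_rel x, φ.denseRange_rel y⟩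
  refine hcl.closure_subset_iff.mpr ?_ hxy
  rintro ⟨_, _⟩ ⟨⟨a, rfl⟩, ⟨b, rfl⟩⟩
  change φ.reduced (a.1 * b.1).1 = φ.reduced a.1.1 * φ.reduced b.1.1
  rw [φ.reduced_of_mem_rel a.2, φ.reduced_of_mem_rel b.2,
    φ.reduced_of_mem_rel (φ.mul_mem_rel a.2 b.2)]
  rfl

theorem reduced_star (x : A.Reduced) : φ.reduced (star x) = star (φ.reduced x) := by
  have hcl : IsClosed {x : A.Reduced | φ.reduced (star x) = star (φ.reduced x)} :=
    isClosed_eq (φ.reduced.continuous.comp continuous_star) φ.reduced.continuous.star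
  refine hcl.closure_subset_iff.mpr ?_ (φ.denseRange_rel x)
  rintro _ ⟨a, rfl⟩
  change φ.reduced (star a.1).1 = star (φ.reduced a.1.1)
  rw [φ.reduced_of_mem_rel a.2, φ.reduced_of_mem_rel (φ.star_mem_rel a.2)]
  rfl

end Hom

end FellBundle

/-! ### Closed ideals of normed algebras -/

/-- A closed two-sided ideal of a (not necessarily unital) complex normed algebra. -/
structure ClosedIdeal (A : Type w) [NonUnitalNormedRing A] [NormedSpace ℂ A] extends
    Submodule ℂ A where
  isClosed' : IsClosed carrier
  mul_mem_left' : ∀ (a : A) {x : A}, x ∈ carrier → a * x ∈ carrier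
  mul_mem_right' : ∀ (a : A) {x : A}, x ∈ carrier → x * a ∈ carrier

namespace ClosedIdeal

variable {A : Type w} [NonUnitalNormedRing A] [NormedSpace ℂ A]

instance : SetLike (ClosedIdeal A) A where
  coe J := J.carrier
  coe_injective I J h := by
    cases I; cases J; congr; exact SetLike.coe_injective h

/-- Ideals are ordered by inclusion. -/
instance : PartialOrder (ClosedIdeal A) where
  le I J := ∀ x, x ∈ I → x ∈ J
  le_refl _ _ := id
  le_trans _ _ _ h h' x hx := h' x (h x hx)
  le_antisymm _ _ h h' := SetLike.coe_injective (Set.Subset.antisymm h h')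

instance : InfSet (ClosedIdeal A) where
  sInf S :=
    { carrier := ⋂ J ∈ S, (J : Set A)
      add_mem' := fun hx hy => Set.mem_iInter₂.mpr fun J hJ =>
        J.add_mem' (Set.mem_iInter₂.mp hx J hJ) (Set.mem_iInter₂.mp hy J hJ)
      zero_mem' := Set.mem_iInter₂.mpr fun J _ => J.zero_mem'
      smul_mem' := fun c _ hx => Set.mem_iInter₂.mpr fun J hJ =>
        J.smul_mem' c (Set.mem_iInter₂.mp hx J hJ)
      isClosed' := isClosed_biInter fun J _ => J.isClosed'
      mul_mem_left' := fun a _ hx => Set.mem_iInter₂.mpr fun J hJ =>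
        J.mul_mem_left' a (Set.mem_iInter₂.mp hx J hJ)
      mul_mem_right' := fun a _ hx => Set.mem_iInter₂.mpr fun J hJ =>
        J.mul_mem_right' a (Set.mem_iInter₂.mp hx J hJ) }

/-- The lattice of closed two-sided ideals. -/
instance : CompleteLattice (ClosedIdeal A) :=
  completeLatticeOfInf _ fun S => by
    constructor
    · intro J hJ x hx
      exact Set.mem_iInter₂.mp hx J hJ
    · intro K hK x hx
      exact Set.mem_iInter₂.mpr fun J hJ => hK hJ x hx

end ClosedIdeal

namespace FellBundle

variable {G : Type u} [Group G] (B : FellBundle.{u, v} G)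

open Filter Topology

/-! ### Ideals of Fell bundles -/

/-- An ideal `J = (J_t)` of a Fell bundle `B`: a closed subspace `J_t` of each fiber `B_t`, such
that `J` is closed under the operations of `B` and under products with elements of `B` on either
side. -/
structure BundleIdeal where
  part : ∀ t, Submodule ℂ (B.fiber t)
  isClosed' : ∀ t, IsClosed (part t : Set (B.fiber t))
  adj_mem' : ∀ {s t : G} (h : s⁻¹ = t) {a : B.fiber s}, a ∈ part s → B.adj h a ∈ part t
  mul_mem_left' : ∀ {s t r : G} (h : s * t = r) (a : B.fiber s) {b : B.fiber t},
    b ∈ part t → B.mul h a b ∈ part r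
  mul_mem_right' : ∀ {s t r : G} (h : s * t = r) {a : B.fiber s} (b : B.fiber t),
    a ∈ part s → B.mul h a b ∈ part r

namespace BundleIdeal

variable {B}

theorem part_injective : Function.Injective (part : B.BundleIdeal → _) := by
  intro I J h
  cases I; cases J; cases h; rfl

/-- Ideals of `B` are ordered by inclusion. -/
instance : PartialOrder B.BundleIdeal where
  le I J := ∀ t, I.part t ≤ J.part t
  le_refl _ _ := le_rfl
  le_trans _ _ _ h h' t := (h t).trans (h' t)
  le_antisymm _ _ h h' := part_injective (funext fun t => le_antisymm (h t) (h' t))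

instance : InfSet B.BundleIdeal where
  sInf S :=
    { part := fun t => ⨅ J ∈ S, J.part t
      isClosed' := fun t => by
        simp only [Submodule.coe_iInf]
        exact isClosed_biInter fun J _ => J.isClosed' t
      adj_mem' := fun h _ ha => by
        simp only [Submodule.mem_iInf] at ha ⊢
        exact fun J hJ => J.adj_mem' h (ha J hJ)
      mul_mem_left' := fun h a _ hb => by
        simp only [Submodule.mem_iInf] at hb ⊢
        exact fun J hJ => J.mul_mem_left' h a (hb J hJ)
      mul_mem_right' := fun h _ b ha => by
        simp only [Submodule.mem_iInf] at ha ⊢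
        exact fun J hJ => J.mul_mem_right' h b (ha J hJ) }

/-- The lattice `𝓘(B)` of ideals of `B`. -/
instance : CompleteLattice B.BundleIdeal :=
  completeLatticeOfInf _ fun S => by
    constructor
    · intro J hJ t x hx
      exact (Submodule.mem_iInf _).mp ((Submodule.mem_iInf _).mp hx J) hJ
    · intro K hK t x hx
      exact (Submodule.mem_iInf _).mpr fun J => (Submodule.mem_iInf _).mpr fun hJ => hK hJ t hx

variable (J : B.BundleIdeal)

/-- The unit fiber of an ideal, as a closed *-subalgebra of `B_1`. -/
def unitPart : NonUnitalStarSubalgebra ℂ (B.fiber 1) where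
  carrier := J.part 1
  add_mem' := (J.part 1).add_mem
  zero_mem' := (J.part 1).zero_mem
  smul_mem' := fun c _ hx => (J.part 1).smul_mem c hx
  mul_mem' := fun {a _} _ hb => J.mul_mem_left' (one_mul 1) a hb
  star_mem' := fun ha => J.adj_mem' inv_one ha

instance : IsClosed (J.unitPart : Set (B.fiber 1)) := J.isClosed' 1

/-- An ideal of a Fell bundle is a Fell bundle with the inherited structure. -/
noncomputable def bundle : FellBundle.{u, v} G where
  fiber t := J.part t
  normed t := inferInstance
  normedSpace t := inferInstance
  complete t := (J.isClosed' t).completeSpace_coe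
  mul h a b := ⟨B.mul h a.1 b.1, J.mul_mem_left' h _ b.2⟩
  adj h a := ⟨B.adj h a.1, J.adj_mem' h a.2⟩
  mul_add' h a b c := Subtype.ext (B.mul_add' h _ _ _)
  add_mul' h a b c := Subtype.ext (B.add_mul' h _ _ _)
  mul_smul' h z a b := Subtype.ext (B.mul_smul' h z _ _)
  smul_mul' h z a b := Subtype.ext (B.smul_mul' h z _ _)
  mul_assoc' h₁ h₂ h₃ h₄ a b c := Subtype.ext (B.mul_assoc' h₁ h₂ h₃ h₄ _ _ _)
  adj_add' h a b := Subtype.ext (B.adj_add' h _ _)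
  adj_smul' h z a := Subtype.ext (B.adj_smul' h z _)
  adj_adj' h h' a := Subtype.ext (B.adj_adj' h h' _)
  adj_mul' h hs ht hu h' a b := Subtype.ext (B.adj_mul' h hs ht hu h' _ _)
  norm_mul_le' h a b := B.norm_mul_le' h a.1 b.1
  norm_adj' h a := B.norm_adj' h a.1
  norm_adj_mul_self' h h' a := B.norm_adj_mul_self' h h' a.1
  adj_mul_self_pos' h h' a := by
    obtain ⟨d, hd⟩ := B.adj_mul_self_pos' h h' a.1
    have hmem : B.mul h' (B.adj h a.1) a.1 ∈ J.unitPart := J.mul_mem_left' h' _ a.2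
    have hnn : 0 ≤ B.mul h' (B.adj h a.1) a.1 := by rw [hd]; exact star_mul_self_nonneg d
    set p := B.mul h' (B.adj h a.1) a.1
    refine ⟨⟨CFC.sqrt p, ?_⟩, Subtype.ext ?_⟩
    · have : CFC.sqrt p ∈ J.unitPart := by
        rw [CFC.sqrt_eq_real_sqrt p hnn]
        exact cfcₙ_mem _ hmem
      exact this
    · have h1 : star (CFC.sqrt p) = CFC.sqrt p :=
        (IsSelfAdjoint.of_nonneg (CFC.sqrt_nonneg p)).star_eq
      change p = star (CFC.sqrt p) * CFC.sqrt p
      rw [h1, CFC.sqrt_mul_sqrt_self p hnn]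

/-- The inclusion of an ideal `J` in `B`. -/
noncomputable def incl : Hom J.bundle B where
  toLin t := (J.part t).subtype
  map_mul' _ _ _ := rfl
  map_adj' _ _ := rfl

/-! ### The quotient of a Fell bundle by an ideal -/

theorem exists_approx {c : B.fiber 1} (hc : c ∈ J.part 1) {ε : ℝ} (hε : 0 < ε) :
    ∃ u ∈ J.part 1, 0 ≤ u ∧ ‖u‖ ≤ 1 ∧ ‖c - c * u‖ < ε := by
  let _ : PartialOrder J.unitPart := CStarAlgebra.spectralOrder _
  let _ : StarOrderedRing J.unitPart := CStarAlgebra.spectralOrderedRing _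
  have hau := CStarAlgebra.increasingApproximateUnit J.unitPart
  have := hau.neBot
  have h1 := hau.tendsto_mul_left (⟨c, hc⟩ : J.unitPart)
  obtain ⟨u, hu1, hu2, hu3⟩ := ((Metric.tendsto_nhds.mp h1 ε hε).and
    (hau.eventually_nonneg.and hau.eventually_norm)).exists
  refine ⟨u.1, u.2, ?_, hu3, ?_⟩
  · obtain ⟨v, hv⟩ := CStarAlgebra.nonneg_iff_eq_star_mul_self.mp hu2
    rw [hv]
    exact star_mul_self_nonneg v.1
  · rw [dist_comm, dist_eq_norm] at hu1
    exact hu1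

theorem norm_compress_le {u : B.fiber 1} (hu : 0 ≤ u) (hu1 : ‖u‖ ≤ 1) (d : B.fiber 1) :
    ‖(d - d * u) - u * (d - d * u)‖ ≤ ‖d‖ := by
  have h0 : ‖(1 : Unitization ℂ (B.fiber 1)) - (u : Unitization ℂ (B.fiber 1))‖ ≤ 1 := by
    have h1 : (u : Unitization ℂ (B.fiber 1)) ∈ Set.Icc 0 1 :=
      CStarAlgebra.mem_Icc_iff_norm_le_one.mpr
        ⟨Unitization.inr_nonneg_iff.mpr hu, by rwa [Unitization.norm_inr]⟩
    exact (CStarAlgebra.mem_Icc_iff_norm_le_one.mp (Set.sub_mem_Icc_zero_iff_right.mpr h1)).2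
  rw [← Unitization.norm_inr (𝕜 := ℂ), ← Unitization.norm_inr (𝕜 := ℂ) (a := d)]
  have h2 : (((d - d * u) - u * (d - d * u) : B.fiber 1) : Unitization ℂ (B.fiber 1)) =
      (1 - (u : Unitization ℂ (B.fiber 1))) * d * (1 - u) := by
    simp only [Unitization.inr_sub, Unitization.inr_mul]
    noncomm_ring
  rw [h2]
  calc _ ≤ ‖1 - (u : Unitization ℂ (B.fiber 1))‖ * ‖(d : Unitization ℂ (B.fiber 1))‖ *
        ‖1 - (u : Unitization ℂ (B.fiber 1))‖ := norm_mul₃_le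
    _ ≤ 1 * ‖(d : Unitization ℂ (B.fiber 1))‖ * 1 := by gcongr
    _ = _ := by ring

instance (t : G) : IsClosed (J.part t : Set (B.fiber t)) := J.isClosed' t

/-- The fiber `B_t / J_t` with the quotient norm. -/
abbrev QuotFiber (t : G) : Type v := B.fiber t ⧸ J.part t

/-- The product of the quotient bundle. -/
noncomputable def quotMul {s t r : G} (h : s * t = r) :
    J.QuotFiber s →ₗ[ℂ] J.QuotFiber t →ₗ[ℂ] J.QuotFiber r :=
  (J.part s).liftQ
    { toFun := fun a => (J.part t).mapQ (J.part r) (B.mulL h a) fun _ hb => J.mul_mem_left' h a hb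
      map_add' := fun a b => by
        ext x
        exact congrArg (Submodule.Quotient.mk (p := J.part r)) (B.add_mul' h a b x)
      map_smul' := fun c a => by
        ext x
        exact congrArg (Submodule.Quotient.mk (p := J.part r)) (B.smul_mul' h c a x) }
    fun a ha => by
      rw [LinearMap.mem_ker]
      ext x
      exact (Submodule.Quotient.mk_eq_zero _).mpr (J.mul_mem_right' h x ha)

theorem quotMul_mk {s t r : G} (h : s * t = r) (a : B.fiber s) (b : B.fiber t) :
    J.quotMul h (Submodule.Quotient.mk a) (Submodule.Quotient.mk b) =
      Submodule.Quotient.mk (B.mul h a b) := rfl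

/-- The adjoint operation of the quotient bundle. -/
def quotAdj {s t : G} (h : s⁻¹ = t) : J.QuotFiber s → J.QuotFiber t :=
  Quotient.map' (B.adj h) fun a b hab => by
    rw [Submodule.quotientRel_def] at hab ⊢
    rw [← B.adj_sub']
    exact J.adj_mem' h hab

theorem quotAdj_mk {s t : G} (h : s⁻¹ = t) (a : B.fiber s) :
    J.quotAdj h (Submodule.Quotient.mk a) = Submodule.Quotient.mk (B.adj h a) := rfl

theorem norm_quotMul_le {s t r : G} (h : s * t = r) (a : J.QuotFiber s) (b : J.QuotFiber t) :
    ‖J.quotMul h a b‖ ≤ ‖a‖ * ‖b‖ := by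
  have key : ∀ ε : ℝ, 0 < ε → ‖J.quotMul h a b‖ ≤ (‖a‖ + ε) * (‖b‖ + ε) := by
    intro ε hε
    obtain ⟨x, rfl, hx⟩ := Submodule.Quotient.norm_mk_lt a hε
    obtain ⟨y, rfl, hy⟩ := Submodule.Quotient.norm_mk_lt b hε
    rw [quotMul_mk]
    refine (Submodule.Quotient.norm_mk_le _ _).trans ((B.norm_mul_le' h x y).trans ?_)
    gcongr
  have hlim : Tendsto (fun ε : ℝ => (‖a‖ + ε) * (‖b‖ + ε)) (𝓝[>] 0) (𝓝 (‖a‖ * ‖b‖)) := by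
    have : Continuous fun ε : ℝ => (‖a‖ + ε) * (‖b‖ + ε) := by fun_prop
    simpa using (this.tendsto 0).mono_left nhdsWithin_le_nhds
  exact ge_of_tendsto hlim (eventually_mem_nhdsWithin.mono fun ε hε => key ε hε)

theorem norm_quotAdj_le {s t : G} (h : s⁻¹ = t) (a : J.QuotFiber s) : ‖J.quotAdj h a‖ ≤ ‖a‖ := by
  refine le_of_forall_pos_le_add fun ε hε => ?_
  obtain ⟨x, rfl, hx⟩ := Submodule.Quotient.norm_mk_lt a hε
  rw [quotAdj_mk]
  refine (Submodule.Quotient.norm_mk_le _ _).trans ?_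
  rw [B.norm_adj']
  exact hx.le

theorem quotAdj_quotAdj {s t : G} (h : s⁻¹ = t) (h' : t⁻¹ = s) (a : J.QuotFiber s) :
    J.quotAdj h' (J.quotAdj h a) = a := by
  obtain ⟨x, rfl⟩ := Submodule.Quotient.mk_surjective _ a
  rw [quotAdj_mk, quotAdj_mk, B.adj_adj']

theorem norm_quotAdj {s t : G} (h : s⁻¹ = t) (a : J.QuotFiber s) : ‖J.quotAdj h a‖ = ‖a‖ := by
  refine le_antisymm (J.norm_quotAdj_le h a) ?_
  have h' : t⁻¹ = s := by rw [← h, inv_inv]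
  conv_lhs => rw [← J.quotAdj_quotAdj h h' a]
  exact J.norm_quotAdj_le h' _

theorem sq_norm_mk_le {t : G} (b : B.fiber t) :
    ‖(Submodule.Quotient.mk b : J.QuotFiber t)‖ ^ 2 ≤
      ‖(Submodule.Quotient.mk (B.ip b b) : J.QuotFiber 1)‖ := by
  refine le_of_forall_pos_le_add fun ε hε => ?_
  obtain ⟨d, hd, hdn⟩ := Submodule.Quotient.norm_mk_lt
    (Submodule.Quotient.mk (B.ip b b) : J.QuotFiber 1) (half_pos hε)
  have hi : B.ip b b - d ∈ J.part 1 := by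
    rw [← Submodule.Quotient.eq]; exact hd.symm
  obtain ⟨u, hu, hu0, hu1, hu2⟩ := J.exists_approx hi (show 0 < ε / 4 by positivity)
  have hus : star u = u := (IsSelfAdjoint.of_nonneg hu0).star_eq
  have h1 : (Submodule.Quotient.mk b : J.QuotFiber t) =
      Submodule.Quotient.mk (b - B.mul (mul_one t) b u) := by
    rw [Submodule.Quotient.eq, sub_sub_cancel]
    exact J.mul_mem_left' _ _ hu
  have h2 : B.ip (b - B.mul (mul_one t) b u) (b - B.mul (mul_one t) b u) =
      ((d - d * u) - u * (d - d * u)) +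
      (((B.ip b b - d) - (B.ip b b - d) * u) - u * ((B.ip b b - d) - (B.ip b b - d) * u)) := by
    simp only [B.ip_sub_right, B.ip_sub_left, B.ip_mul_left, B.ip_mul_right, hus]
    noncomm_ring
  set i := B.ip b b - d
  have h3 : ‖(i - i * u) - u * (i - i * u)‖ ≤ ε / 2 := by
    refine (norm_sub_le _ _).trans ?_
    have := (norm_mul_le u (i - i * u)).trans
      (mul_le_mul_of_nonneg_right hu1 (norm_nonneg (i - i * u)))
    linarith
  rw [h1]
  calc _ ≤ ‖b - B.mul (mul_one t) b u‖ ^ 2 := by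
        gcongr
        exact Submodule.Quotient.norm_mk_le _ _
    _ ≤ _ := by
        rw [← B.norm_ip_self, h2]
        refine (norm_add_le _ _).trans ?_
        have := norm_compress_le hu0 hu1 d
        linarith

/-- The quotient Fell bundle `B/J`, with fibers `B_t/J_t`. -/
noncomputable def quotient : FellBundle.{u, v} G where
  fiber t := J.QuotFiber t
  normed t := inferInstance
  normedSpace t := inferInstance
  complete t := inferInstance
  mul h a b := J.quotMul h a b
  adj h a := J.quotAdj h a
  mul_add' h a b c := map_add _ _ _
  add_mul' h a b c := by rw [map_add]; rfl
  mul_smul' h z a b := map_smul _ _ _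
  smul_mul' h z a b := by rw [map_smul]; rfl
  mul_assoc' h₁ h₂ h₃ h₄ a b c := by
    obtain ⟨a, rfl⟩ := Submodule.Quotient.mk_surjective _ a
    obtain ⟨b, rfl⟩ := Submodule.Quotient.mk_surjective _ b
    obtain ⟨c, rfl⟩ := Submodule.Quotient.mk_surjective _ c
    simp only [quotMul_mk, B.mul_assoc' h₁ h₂ h₃ h₄]
  adj_add' h a b := by
    obtain ⟨a, rfl⟩ := Submodule.Quotient.mk_surjective _ a
    obtain ⟨b, rfl⟩ := Submodule.Quotient.mk_surjective _ b
    simp only [← Submodule.Quotient.mk_add, quotAdj_mk, B.adj_add']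
  adj_smul' h z a := by
    obtain ⟨a, rfl⟩ := Submodule.Quotient.mk_surjective _ a
    simp only [← Submodule.Quotient.mk_smul, quotAdj_mk, B.adj_smul']
  adj_adj' h h' a := J.quotAdj_quotAdj h h' a
  adj_mul' h hs ht hu h' a b := by
    obtain ⟨a, rfl⟩ := Submodule.Quotient.mk_surjective _ a
    obtain ⟨b, rfl⟩ := Submodule.Quotient.mk_surjective _ b
    simp only [quotMul_mk, quotAdj_mk, B.adj_mul' h hs ht hu h']
  norm_mul_le' h a b := J.norm_quotMul_le h a b
  norm_adj' h a := J.norm_quotAdj h a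
  norm_adj_mul_self' h h' a := by
    refine le_antisymm ?_ ?_
    · refine (J.norm_quotMul_le h' _ _).trans_eq ?_
      rw [J.norm_quotAdj, pow_two]
    · obtain ⟨a, rfl⟩ := Submodule.Quotient.mk_surjective _ a
      subst h
      exact J.sq_norm_mk_le a
  adj_mul_self_pos' h h' a := by
    obtain ⟨a, rfl⟩ := Submodule.Quotient.mk_surjective _ a
    obtain ⟨c, hc⟩ := B.adj_mul_self_pos' h h' a
    exact ⟨Submodule.Quotient.mk c, congrArg (Submodule.Quotient.mk (p := J.part 1)) hc⟩

/-- The quotient map `B → B/J`. -/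
noncomputable def proj : Hom B J.quotient where
  toLin t := (J.part t).mkQ
  map_mul' _ _ _ := rfl
  map_adj' _ _ := rfl

end BundleIdeal

/-! ### The ideals `C*_r(I)`, and the properties of Fell bundles -/

/-- The image in `C*_r(B)` of the finitely supported sections of `I`. -/
noncomputable def finSuppOf (I : B.BundleIdeal) : Submodule ℂ B.Reduced :=
  ⨆ t, (I.part t).map (B.toReduced t)

variable {B} in
theorem finSuppOf_induction {I : B.BundleIdeal} (p : B.Reduced → Prop) (h0 : p 0)
    (hadd : ∀ x y, p x → p y → p (x + y))
    (h : ∀ t, ∀ b ∈ I.part t, p (B.toReduced t b)) {x : B.Reduced} (hx : x ∈ B.finSuppOf I) :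
    p x := by
  refine Submodule.iSup_induction (motive := p) _ hx ?_ h0 hadd
  rintro t _ ⟨b, hb, rfl⟩
  exact h t b hb

theorem toReduced_mem_finSuppOf {I : B.BundleIdeal} {t : G} {b : B.fiber t} (hb : b ∈ I.part t) :
    B.toReduced t b ∈ B.finSuppOf I := Submodule.mem_iSup_of_mem t ⟨b, hb, rfl⟩

theorem mul_mem_finSuppOf_left {I : B.BundleIdeal} {x y : B.Reduced} (hx : x ∈ B.finSupp)
    (hy : y ∈ B.finSuppOf I) : x * y ∈ B.finSuppOf I := by
  refine finSupp_induction (fun x => x * y ∈ B.finSuppOf I) (by simp)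
    (fun a b ha hb => by rw [add_mul]; exact add_mem ha hb) (fun t a => ?_) hx
  refine finSuppOf_induction (fun y => B.toReduced t a * y ∈ B.finSuppOf I) (by simp)
    (fun a b ha hb => by rw [mul_add]; exact add_mem ha hb) (fun s b hb => ?_) hy
  rw [← B.toReduced_mul rfl]
  exact B.toReduced_mem_finSuppOf (I.mul_mem_left' _ _ hb)

theorem mul_mem_finSuppOf_right {I : B.BundleIdeal} {x y : B.Reduced} (hx : x ∈ B.finSuppOf I)
    (hy : y ∈ B.finSupp) : x * y ∈ B.finSuppOf I := by
  refine finSuppOf_induction (fun x => x * y ∈ B.finSuppOf I) (by simp)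
    (fun a b ha hb => by rw [add_mul]; exact add_mem ha hb) (fun t a ha => ?_) hx
  refine finSupp_induction (fun y => B.toReduced t a * y ∈ B.finSuppOf I) (by simp)
    (fun a b ha hb => by rw [mul_add]; exact add_mem ha hb) (fun s b => ?_) hy
  rw [← B.toReduced_mul rfl]
  exact B.toReduced_mem_finSuppOf (I.mul_mem_right' _ _ ha)

/-- The ideal `μ(I) = C*_r(I)` of `C*_r(B)`, where `C*_r(I)` is identified with the closure in
`C*_r(B)` of the finitely supported sections of `I`. -/
noncomputable def reducedIdeal (I : B.BundleIdeal) : ClosedIdeal B.Reduced where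
  toSubmodule := (B.finSuppOf I).topologicalClosure
  isClosed' := Submodule.isClosed_topologicalClosure _
  mul_mem_left' a _ hx := map_mem_closure₂ continuous_mul (B.dense_finSupp a) hx
    fun _ ha _ hy => B.mul_mem_finSuppOf_left ha hy
  mul_mem_right' a _ hx := map_mem_closure₂ continuous_mul hx (B.dense_finSupp a)
    fun _ hy _ ha => B.mul_mem_finSuppOf_right hy ha

/-- The exactness property of `B` at the ideal `I`: the sequence
`0 → C*_r(I) → C*_r(B) → C*_r(B/I) → 0` induced by the inclusion and the quotient map is exact. -/
def ExactAt (I : B.BundleIdeal) : Prop :=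
  Function.Injective I.incl.reduced ∧ Function.Exact I.incl.reduced I.proj.reduced ∧
    Function.Surjective I.proj.reduced

/-- The exactness property. -/
def HasExactness : Prop := ∀ I : B.BundleIdeal, B.ExactAt I

/-- The intersection property of `B` at the ideal `I`: every nonzero ideal of `C*_r(B/I)` has
nonzero intersection with `B_1/I_1`. -/
def IntersectionAt (I : B.BundleIdeal) : Prop :=
  ∀ K : ClosedIdeal I.quotient.Reduced, (∃ x ∈ K, x ≠ 0) →
    ∃ b : I.quotient.fiber 1, I.quotient.toReduced 1 b ∈ K ∧ I.quotient.toReduced 1 b ≠ 0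

/-- The residual intersection property. -/
def HasResidualIntersection : Prop := ∀ I : B.BundleIdeal, B.IntersectionAt I

variable {B} in
/-- An ideal `J` of `C*_r(B)` is diagonal invariant if `E(J) ⊆ J`, where `B_1` is identified with
its image in `C*_r(B)`. -/
def DiagonalInvariant (J : ClosedIdeal B.Reduced) : Prop :=
  ∀ x ∈ J, B.toReduced 1 (B.condExp x) ∈ J

end FellBundle

/-!
The map `I ↦ C*_r(I)` is always an order embedding: applying the conditional expectation `E` to
`C*_r(I)` gives elements of `I_1`, and `b ∈ I_t` if and only if `b* b ∈ I_1`, so that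
`C*_r(I) ∩ B_t = I_t` (`toReduced_mem_reducedIdeal_iff`). Conversely an ideal `J` of `C*_r(B)` cuts
out the ideal `(J ∩ B_t)_t` of `B` (`fiberIdeal`). Hence the lattices are isomorphic through
`I ↦ C*_r(I)` exactly when each `J` is contained in, and so equal to, `C*_r((J ∩ B_t)_t)`
(`exists_orderIso_iff`).

The analytic input is the faithfulness of `E` (`eq_zero_of_condExp_star_mul_self`). Together with
the naturality of `E` under morphisms of Fell bundles it identifies the kernel of
`p_r : C*_r(B) → C*_r(B/I)` with `{x | E(x* x) ∈ I_1}`, and shows that `i_r` is injective. As ranges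
of *-homomorphisms of C*-algebras are closed, the exactness property reduces to the inclusion of
that kernel in `C*_r(I)` (`exactAt_iff`).

Given exactness, put `I = (J ∩ B_t)_t`. If `J` is diagonal invariant, then `E(x* x) ∈ J ∩ B_1 = I_1`
for `x ∈ J`, hence `J ⊆ ker p_r = C*_r(I)`. If the residual intersection property holds, then
`p_r(J)` is an ideal of `C*_r(B/I)` that meets `B_1/I_1` trivially, hence it is zero and again
`J ⊆ ker p_r`. In the other direction, when all ideals have the form `C*_r(I)`, one applies this to
the kernel of `p_r` to obtain exactness, and to the inverse image under `p_r` of an ideal of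
`C*_r(B/I)` to obtain the residual intersection property; diagonal invariance of `C*_r(I)` is clear.
-/

/-! ### Star-homomorphisms and ideals of C*-algebras -/

section CStarAlgebra

variable {A : Type v} {B : Type w} [NonUnitalCStarAlgebra A] [NonUnitalCStarAlgebra B]

theorem NonUnitalStarAlgHom.exists_norm_le_of_isSelfAdjoint (φ : A →⋆ₙₐ[ℂ] B) {x : A}
    (hx : IsSelfAdjoint x) : ∃ y, φ y = φ x ∧ ‖y‖ ≤ ‖φ x‖ := by
  set M := ‖φ x‖
  have hM : 0 ≤ M := norm_nonneg _
  have hφ : Continuous φ := AddMonoidHomClass.continuous_of_bound φ 1 fun a => by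
    rw [one_mul]; exact NonUnitalStarAlgHom.norm_apply_le φ a
  -- Truncation at `±‖φ x‖` fixes `φ x` and bounds the norm of the preimage.
  let f : ℝ → ℝ := fun t => max (-M) (min M t)
  have hf : Continuous f := by fun_prop
  have hf0 : f 0 = 0 := by simp [f, hM]
  refine ⟨cfcₙ f x, ?_, ?_⟩
  · rw [NonUnitalStarAlgHom.map_cfcₙ (R := ℝ) (S := ℂ) φ f x hf.continuousOn hf0 hφ hx (hx.map φ)]
    refine (cfcₙ_congr fun t ht => ?_).trans (cfcₙ_id ℝ (φ x) (hx.map φ))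
    have h1 := norm_apply_le_norm_cfcₙ (id : ℝ → ℝ) (φ x) ht continuousOn_id rfl (hx.map φ)
    rw [cfcₙ_id ℝ (φ x) (hx.map φ), id, Real.norm_eq_abs, abs_le] at h1
    simp only [f, id]
    rw [min_eq_right h1.2, max_eq_right h1.1]
  · refine norm_cfcₙ_le fun t _ => ?_
    rw [Real.norm_eq_abs, abs_le]
    exact ⟨le_max_left _ _, max_le (by linarith) (min_le_left _ _)⟩

theorem NonUnitalStarAlgHom.exists_norm_le_two_mul (φ : A →⋆ₙₐ[ℂ] B) (x : A) :
    ∃ y, φ y = φ x ∧ ‖y‖ ≤ 2 * ‖φ x‖ := by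
  obtain ⟨a, ha, ha'⟩ := φ.exists_norm_le_of_isSelfAdjoint (realPart x).2
  obtain ⟨b, hb, hb'⟩ := φ.exists_norm_le_of_isSelfAdjoint (imaginaryPart x).2
  have hr (r : ℝ) (y : A) : φ (r • y) = r • φ y := by simpa using map_smul φ (r : ℂ) y
  have hre : φ (realPart x : A) = realPart (φ x) := by
    rw [realPart_apply_coe, realPart_apply_coe, hr, map_add, map_star]
  have him : φ (imaginaryPart x : A) = imaginaryPart (φ x) := by
    rw [imaginaryPart_apply_coe, imaginaryPart_apply_coe, map_smul, hr, map_sub, map_star]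
  refine ⟨a + Complex.I • b, ?_, ?_⟩
  · rw [map_add, map_smul, ha, hb, ← map_smul, ← map_add, realPart_add_I_smul_imaginaryPart]
  · rw [hre] at ha'
    rw [him] at hb'
    have h1 : ‖(realPart (φ x) : B)‖ ≤ ‖φ x‖ := realPart.norm_le (φ x)
    have h2 : ‖(imaginaryPart (φ x) : B)‖ ≤ ‖φ x‖ := imaginaryPart.norm_le (φ x)
    have h3 := norm_add_le a (Complex.I • b)
    rw [norm_smul, Complex.norm_I, one_mul] at h3
    linarith

/-- The range of a *-homomorphism of C*-algebras is closed: elements of the range have preimages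
of controlled norm. -/
theorem NonUnitalStarAlgHom.isClosed_range (φ : A →⋆ₙₐ[ℂ] B) : IsClosed (Set.range φ) := by
  let f : NormedAddGroupHom A B := (φ : A →+ B).mkNormedAddGroupHom 1 fun a => by
    rw [one_mul]; exact NonUnitalStarAlgHom.norm_apply_le φ a
  have h := controlled_closure_of_complete (f := f) (K := f.range) (C := 2) (ε := 1)
    two_pos one_pos (by
      rintro _ ⟨x, rfl⟩
      exact φ.exists_norm_le_two_mul x)
  refine isClosed_of_closure_subset fun y hy => ?_
  obtain ⟨x, hx, -⟩ := h y hy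
  exact ⟨x, hx⟩

namespace ClosedIdeal

variable {J : ClosedIdeal A}

theorem add_mem {x y : A} (hx : x ∈ J) (hy : y ∈ J) : x + y ∈ J := J.add_mem' hx hy
theorem zero_mem : (0 : A) ∈ J := J.zero_mem'
theorem smul_mem (c : ℂ) {x : A} (hx : x ∈ J) : c • x ∈ J := J.smul_mem' c hx
theorem mul_mem_left (a : A) {x : A} (hx : x ∈ J) : a * x ∈ J := J.mul_mem_left' a hx
theorem mul_mem_right (a : A) {x : A} (hx : x ∈ J) : x * a ∈ J := J.mul_mem_right' a hx

variable (J) in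
/-- The closed *-subalgebra `J ∩ J*` attached to a closed ideal `J`; it is equal to `J`, but this
is only proved by means of its approximate units. -/
def starPart : NonUnitalStarSubalgebra ℂ A where
  carrier := {x | x ∈ J ∧ star x ∈ J}
  add_mem' hx hy := ⟨add_mem hx.1 hy.1, by rw [star_add]; exact add_mem hx.2 hy.2⟩
  zero_mem' := ⟨zero_mem, by rw [star_zero]; exact zero_mem⟩
  smul_mem' c _ hx := ⟨smul_mem c hx.1, by rw [star_smul]; exact smul_mem _ hx.2⟩
  mul_mem' hx hy := ⟨mul_mem_left _ hy.1, by rw [star_mul]; exact mul_mem_left _ hx.2⟩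
  star_mem' hx := ⟨hx.2, by rw [star_star]; exact hx.1⟩

instance : IsClosed (J.starPart : Set A) :=
  J.isClosed'.inter (J.isClosed'.preimage continuous_star)

/-- Closed ideals of C*-algebras are self-adjoint. With an approximate unit `u` of `J ∩ J*`,
`‖x* - x* u‖ ^ 2 = ‖(1 - u) x x* (1 - u)‖` tends to `0`, because `x x*` lies in `J ∩ J*`. -/
theorem star_mem {x : A} (hx : x ∈ J) : star x ∈ J := by
  let _ : PartialOrder J.starPart := CStarAlgebra.spectralOrder _
  let _ : StarOrderedRing J.starPart := CStarAlgebra.spectralOrderedRing _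
  have hp : x * star x ∈ J.starPart :=
    ⟨mul_mem_right _ hx, by rw [star_mul, star_star]; exact mul_mem_right _ hx⟩
  refine J.isClosed'.closure_subset_iff.mpr subset_rfl ?_
  rw [Metric.mem_closure_iff]
  intro ε hε
  have hau := CStarAlgebra.increasingApproximateUnit J.starPart
  have := hau.neBot
  have h1 := hau.tendsto_mul_left (⟨x * star x, hp⟩ : J.starPart)
  obtain ⟨u, hu1, hu2, hu3⟩ := ((Metric.tendsto_nhds.mp h1 (ε ^ 2 / 2) (by positivity)).and
    (hau.eventually_nonneg.and hau.eventually_norm)).exists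
  refine ⟨star x * u.1, mul_mem_left _ u.2.1, ?_⟩
  have hus : star u.1 = u.1 := congrArg Subtype.val (IsSelfAdjoint.of_nonneg hu2).star_eq
  have hu3' : ‖u.1‖ ≤ 1 := hu3
  rw [dist_comm, dist_eq_norm] at hu1
  have hu1' : ‖x * star x - x * star x * u.1‖ < ε ^ 2 / 2 := hu1
  rw [dist_eq_norm]
  refine lt_of_pow_lt_pow_left₀ 2 hε.le ?_
  set p := x * star x - x * star x * u.1 with hpdef
  have h2 : star (star x - star x * u.1) * (star x - star x * u.1) = p - u.1 * p := by
    simp only [hpdef, star_sub, star_mul, star_star, hus]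
    noncomm_ring
  rw [pow_two, ← CStarRing.norm_star_mul_self, h2]
  have h3 := norm_sub_le p (u.1 * p)
  have h4 := (norm_mul_le u.1 p).trans (mul_le_mul_of_nonneg_right hu3' (norm_nonneg p))
  linarith

/-- The inverse image of a closed ideal under a continuous homomorphism. -/
def comap (φ : A →L[ℂ] B) (hφ : ∀ x y, φ (x * y) = φ x * φ y) (K : ClosedIdeal B) :
    ClosedIdeal A where
  toSubmodule := K.toSubmodule.comap φ.toLinearMap
  isClosed' := K.isClosed'.preimage φ.continuous
  mul_mem_left' a x hx := by
    change φ (a * x) ∈ K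
    rw [hφ]
    exact mul_mem_left _ hx
  mul_mem_right' a x hx := by
    change φ (x * a) ∈ K
    rw [hφ]
    exact mul_mem_right _ hx

/-- The kernel of a continuous homomorphism. -/
def ker (φ : A →L[ℂ] B) (hφ : ∀ x y, φ (x * y) = φ x * φ y) : ClosedIdeal A where
  toSubmodule := LinearMap.ker φ.toLinearMap
  isClosed' := φ.isClosed_ker
  mul_mem_left' a x hx := by
    have hx' : φ x = 0 := hx
    change φ (a * x) = 0
    rw [hφ, hx', mul_zero]
  mul_mem_right' a x hx := by
    have hx' : φ x = 0 := hx
    change φ (x * a) = 0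
    rw [hφ, hx', zero_mul]

/-- The image of a closed ideal that contains the kernel of a surjective continuous homomorphism.
It is closed by the open mapping theorem. -/
def map (φ : A →L[ℂ] B) (hφ : ∀ x y, φ (x * y) = φ x * φ y) (hs : Function.Surjective φ)
    (J : ClosedIdeal A) (hJ : ∀ x, φ x = 0 → x ∈ J) : ClosedIdeal B where
  toSubmodule := J.toSubmodule.map φ.toLinearMap
  isClosed' := by
    have hpre : φ ⁻¹' (φ '' (J : Set A)) = J := by
      refine Set.Subset.antisymm ?_ (Set.subset_preimage_image _ _)
      rintro x ⟨y, hy, hyx⟩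
      have h := add_mem (hJ (x - y) (by rw [map_sub, hyx, sub_self])) hy
      rwa [sub_add_cancel] at h
    refine (φ.isQuotientMap hs).isClosed_preimage.mp ?_
    change IsClosed (φ ⁻¹' (φ '' (J : Set A)))
    rw [hpre]
    exact J.isClosed'
  mul_mem_left' b := by
    rintro _ ⟨x, hx, rfl⟩
    obtain ⟨a, rfl⟩ := hs b
    exact ⟨a * x, mul_mem_left a hx, hφ a x⟩
  mul_mem_right' b := by
    rintro _ ⟨x, hx, rfl⟩
    obtain ⟨a, rfl⟩ := hs b
    exact ⟨x * a, mul_mem_right a hx, hφ x a⟩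

theorem mem_map_iff {φ : A →L[ℂ] B} {hφ : ∀ x y, φ (x * y) = φ x * φ y}
    {hs : Function.Surjective φ} {hJ : ∀ x, φ x = 0 → x ∈ J} {x : A} :
    φ x ∈ map φ hφ hs J hJ ↔ x ∈ J := by
  refine ⟨?_, fun hx => ⟨x, hx, rfl⟩⟩
  rintro ⟨y, hy, hyx⟩
  have hyx' : φ y = φ x := hyx
  have h := add_mem (hJ (x - y) (by rw [map_sub, hyx', sub_self])) hy
  rwa [sub_add_cancel] at h

end ClosedIdeal

end CStarAlgebra

namespace FellBundle

variable {G : Type u} [Group G] (B : FellBundle.{u, v} G)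

/-! ### Faithfulness and naturality of the conditional expectation -/

theorem continuous_mul_left {s t r : G} (h : s * t = r) (b : B.fiber t) :
    Continuous fun a : B.fiber s => B.mul h a b :=
  (((B.mulL h).flip b).mkContinuous ‖b‖ fun a =>
    (B.norm_mul_le' h a b).trans_eq (mul_comm _ _)).continuous

/-- All diagonal coefficients of `x ∈ C*_r(B)`, not only the one at the unit, are given by
`E(x)`. -/
theorem op_single_apply_same (x : B.Reduced) (s : G) (b : B.fiber s) :
    Reduced.op B x (L2.single B s b) s = B.mul (one_mul s) (B.condExp x) b := by
  have hcl : IsClosed {x : B.Reduced | Reduced.op B x (L2.single B s b) s =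
      B.mul (one_mul s) (B.condExp x) b} :=
    isClosed_eq
      ((L2.eval s).continuous.comp ((ContinuousLinearMap.apply ℂ B.L2
        (L2.single B s b)).continuous.comp (Reduced.op B).continuous))
      ((B.continuous_mul_left (one_mul s) b).comp B.condExp.continuous)
  refine hcl.closure_subset_iff.mpr (fun y hy => ?_) (B.dense_finSupp x)
  refine finSupp_induction (fun x => Reduced.op B x (L2.single B s b) s =
      B.mul (one_mul s) (B.condExp x) b) ?_ ?_ ?_ hy
  · rw [map_zero, map_zero, B.zero_mul']
    rfl
  · intro x y hx hy
    rw [map_add, map_add, B.add_mul', ← hx, ← hy]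
    rfl
  · intro t a
    rw [op_toReduced]
    by_cases ht : t = 1
    · subst ht
      rw [B.lamCLM_single (one_mul s), L2.single_same, B.condExp_toReduced_one]
    · rw [B.lamCLM_single rfl, L2.single_ne B (by simpa using ht),
        B.condExp_toReduced_ne ht, B.zero_mul']

/-- The conditional expectation is faithful: if `E(x* x) = 0`, then
`⟨x ξ, x ξ⟩ = b* E(x* x) b = 0` for each section `ξ = b δ_s`, and these sections span a dense
subspace of `ℓ²(B)`. -/
theorem eq_zero_of_condExp_star_mul_self {x : B.Reduced} (hx : B.condExp (star x * x) = 0) :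
    x = 0 := by
  have h1 : ∀ (s : G) (b : B.fiber s), Reduced.op B x (L2.single B s b) = 0 := by
    intro s b
    rw [← norm_eq_zero, ← sq_eq_zero_iff, L2.norm_sq, Reduced.isAdj_op B x]
    change ‖L2.inner _ (Reduced.op B (star x * x) (L2.single B s b))‖ = 0
    rw [L2.inner_single, op_single_apply_same, hx, B.zero_mul', B.ip_zero_right, norm_zero]
  have h2 : Reduced.op B x = 0 := by
    ext1 ξ
    have hcl : IsClosed {ξ : B.L2 | Reduced.op B x ξ = 0} :=
      isClosed_eq (Reduced.op B x).continuous continuous_const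
    refine hcl.closure_subset_iff.mpr (fun η hη => ?_) (L2.mem_closure_single B ξ)
    refine Submodule.iSup_induction (motive := fun η => Reduced.op B x η = 0) _ hη ?_
      (map_zero _) fun a b ha hb => by rw [map_add, ha, hb, add_zero]
    rintro s _ ⟨b, rfl⟩
    exact h1 s b
  rw [← norm_eq_zero, ← Reduced.norm_op, h2, norm_zero]

theorem toReduced_ip {t : G} (b : B.fiber t) :
    B.toReduced 1 (B.ip b b) = star (B.toReduced t b) * B.toReduced t b := by
  rw [B.star_toReduced rfl, ← B.toReduced_mul (inv_mul_cancel t)]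
  rfl

theorem toReduced_injective (t : G) : Function.Injective (B.toReduced t) := by
  refine (injective_iff_map_eq_zero _).mpr fun b hb => ?_
  have h := congrArg B.condExp (B.toReduced_ip b)
  rw [hb, mul_zero, map_zero, B.condExp_toReduced_one] at h
  have h2 := B.norm_ip_self b
  rw [h, norm_zero] at h2
  simpa using h2.symm

namespace Hom

variable {A : FellBundle.{u, v} G} {B : FellBundle.{u, w} G} (φ : Hom A B)

/-- The conditional expectations are natural: `E(φ_r(x)) = φ(E(x))`. -/
theorem condExp_reduced (x : A.Reduced) : B.condExp (φ.reduced x) = φ.toLin 1 (A.condExp x) := by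
  have hφ : Continuous (φ.toLin 1) :=
    ((φ.toLin 1).mkContinuous 1 fun a => by rw [one_mul]; exact φ.norm_unitHom_le a).continuous
  have hcl : IsClosed {x : A.Reduced | B.condExp (φ.reduced x) = φ.toLin 1 (A.condExp x)} :=
    isClosed_eq (B.condExp.continuous.comp φ.reduced.continuous)
      (hφ.comp A.condExp.continuous)
  refine hcl.closure_subset_iff.mpr (fun y hy => ?_) (A.dense_finSupp x)
  refine finSupp_induction
    (fun x => B.condExp (φ.reduced x) = φ.toLin 1 (A.condExp x)) (by simp) ?_ ?_ hy
  · intro x y hx hy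
    rw [map_add, map_add, map_add, map_add, hx, hy]
  · intro t a
    rw [φ.reduced_toReduced]
    by_cases ht : t = 1
    · subst ht
      rw [A.condExp_toReduced_one, B.condExp_toReduced_one]
    · rw [A.condExp_toReduced_ne ht, B.condExp_toReduced_ne ht, map_zero]

theorem reduced_eq_zero_iff (x : A.Reduced) :
    φ.reduced x = 0 ↔ φ.toLin 1 (A.condExp (star x * x)) = 0 := by
  rw [← φ.condExp_reduced, φ.reduced_mul, φ.reduced_star]
  exact ⟨fun h => by rw [h, mul_zero, map_zero], B.eq_zero_of_condExp_star_mul_self⟩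

/-- The induced map of reduced algebras as a *-homomorphism. -/
noncomputable def reducedHom : A.Reduced →⋆ₙₐ[ℂ] B.Reduced where
  toFun := φ.reduced
  map_smul' c x := map_smul φ.reduced c x
  map_zero' := map_zero φ.reduced
  map_add' x y := map_add φ.reduced x y
  map_mul' x y := φ.reduced_mul x y
  map_star' x := φ.reduced_star x

theorem isClosed_range_reduced : IsClosed (Set.range φ.reduced) := φ.reducedHom.isClosed_range

theorem reduced_injective (h : Function.Injective (φ.toLin 1)) : Function.Injective φ.reduced := by
  refine (injective_iff_map_eq_zero _).mpr fun x hx => ?_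
  rw [φ.reduced_eq_zero_iff, map_eq_zero_iff _ h] at hx
  exact A.eq_zero_of_condExp_star_mul_self hx

theorem reduced_surjective (h : ∀ t, Function.Surjective (φ.toLin t)) :
    Function.Surjective φ.reduced := by
  intro y
  refine φ.isClosed_range_reduced.closure_subset_iff.mpr (fun z hz => ?_) (B.dense_finSupp y)
  refine finSupp_induction (fun z => z ∈ Set.range φ.reduced) ⟨0, map_zero _⟩ ?_ ?_ hz
  · rintro _ _ ⟨a, rfl⟩ ⟨b, rfl⟩
    exact ⟨a + b, map_add _ _ _⟩
  · intro t b
    obtain ⟨a, rfl⟩ := h t b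
    exact ⟨_, φ.reduced_toReduced a⟩

end Hom

/-! ### Ideals of a Fell bundle and ideals of its reduced algebra -/

variable {B}

/-- The fibers of an ideal are determined by its unit fiber: `b ∈ I_t` if and only if
`b* b ∈ I_1`. -/
theorem BundleIdeal.mem_part_iff_ip (I : B.BundleIdeal) {t : G} {b : B.fiber t} :
    b ∈ I.part t ↔ B.ip b b ∈ I.part 1 := by
  refine ⟨fun hb => I.mul_mem_left' _ _ hb, fun hb => ?_⟩
  have h := I.sq_norm_mk_le b
  rw [(Submodule.Quotient.mk_eq_zero (I.part 1)).mpr hb, norm_zero] at h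
  rw [← Submodule.Quotient.mk_eq_zero, ← norm_eq_zero]
  exact pow_eq_zero_iff two_ne_zero |>.mp (le_antisymm h (sq_nonneg _))

theorem condExp_mem_of_mem_reducedIdeal {I : B.BundleIdeal} {x : B.Reduced}
    (hx : x ∈ B.reducedIdeal I) : B.condExp x ∈ I.part 1 := by
  have hcl : IsClosed {x : B.Reduced | B.condExp x ∈ I.part 1} :=
    (I.isClosed' 1).preimage B.condExp.continuous
  refine hcl.closure_subset_iff.mpr (fun y hy => ?_) hx
  refine finSuppOf_induction (fun x => B.condExp x ∈ I.part 1) (by simp)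
    (fun x y hx hy => by rw [map_add]; exact add_mem hx hy) (fun t b hb => ?_) hy
  by_cases ht : t = 1
  · subst ht
    rwa [B.condExp_toReduced_one]
  · rw [B.condExp_toReduced_ne ht]
    exact zero_mem _

theorem toReduced_mem_reducedIdeal_iff {I : B.BundleIdeal} {t : G} {b : B.fiber t} :
    B.toReduced t b ∈ B.reducedIdeal I ↔ b ∈ I.part t := by
  refine ⟨fun hb => ?_, fun hb => subset_closure (B.toReduced_mem_finSuppOf hb)⟩
  rw [I.mem_part_iff_ip, ← B.condExp_toReduced_one (B.ip b b), B.toReduced_ip]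
  exact condExp_mem_of_mem_reducedIdeal (ClosedIdeal.mul_mem_left _ hb)

theorem reducedIdeal_le_iff {I : B.BundleIdeal} {J : ClosedIdeal B.Reduced} :
    B.reducedIdeal I ≤ J ↔ ∀ t, ∀ b ∈ I.part t, B.toReduced t b ∈ J := by
  refine ⟨fun h t b hb => h _ (toReduced_mem_reducedIdeal_iff.mpr hb), fun h x hx => ?_⟩
  refine J.isClosed'.closure_subset_iff.mpr (fun y hy => ?_) hx
  exact finSuppOf_induction (fun y => y ∈ J) ClosedIdeal.zero_mem
    (fun _ _ => ClosedIdeal.add_mem) h hy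

theorem reducedIdeal_le_reducedIdeal_iff {I I' : B.BundleIdeal} :
    B.reducedIdeal I ≤ B.reducedIdeal I' ↔ I ≤ I' := by
  simp only [reducedIdeal_le_iff, toReduced_mem_reducedIdeal_iff]
  rfl

theorem diagonalInvariant_reducedIdeal (I : B.BundleIdeal) :
    DiagonalInvariant (B.reducedIdeal I) := fun _ hx =>
  toReduced_mem_reducedIdeal_iff.mpr (condExp_mem_of_mem_reducedIdeal hx)

/-- The ideal `(J ∩ B_t)_t` of `B` cut out by an ideal `J` of `C*_r(B)`. -/
noncomputable def fiberIdeal (J : ClosedIdeal B.Reduced) : B.BundleIdeal where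
  part t := J.toSubmodule.comap (B.toReduced t)
  isClosed' t := by
    have hc : Continuous (B.toReduced t) :=
      ((B.toReduced t).mkContinuous 1 fun b => by
        rw [one_mul]
        exact (B.lamCLM b).opNorm_le_bound (norm_nonneg b) fun x =>
          L2.norm_le_of_fnorm_le _ fun F => (B.fnorm_lam_le b x F).trans
            (mul_le_mul_of_nonneg_left (L2.fnorm_le x _) (norm_nonneg b))).continuous
    exact J.isClosed'.preimage hc
  adj_mem' {s t} h a ha := by
    change B.toReduced t (B.adj h a) ∈ J
    rw [← B.star_toReduced h]
    exact ClosedIdeal.star_mem ha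
  mul_mem_left' {s t r} h a b hb := by
    change B.toReduced r (B.mul h a b) ∈ J
    rw [B.toReduced_mul]
    exact ClosedIdeal.mul_mem_left _ hb
  mul_mem_right' {s t r} h a b ha := by
    change B.toReduced r (B.mul h a b) ∈ J
    rw [B.toReduced_mul]
    exact ClosedIdeal.mul_mem_right _ ha

theorem reducedIdeal_fiberIdeal_le (J : ClosedIdeal B.Reduced) :
    B.reducedIdeal (fiberIdeal J) ≤ J := reducedIdeal_le_iff.mpr fun _ _ hb => hb

/-! ### Exactness -/

namespace BundleIdeal

variable (I : B.BundleIdeal)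

theorem range_incl_reduced : Set.range I.incl.reduced = (B.reducedIdeal I : Set B.Reduced) := by
  refine Set.Subset.antisymm ?_ ?_
  · rintro _ ⟨x, rfl⟩
    have hcl : IsClosed {x : I.bundle.Reduced | I.incl.reduced x ∈ B.reducedIdeal I} :=
      (B.reducedIdeal I).isClosed'.preimage I.incl.reduced.continuous
    refine hcl.closure_subset_iff.mpr (fun y hy => ?_) (I.bundle.dense_finSupp x)
    refine finSupp_induction (fun x => I.incl.reduced x ∈ B.reducedIdeal I) ?_ ?_ ?_ hy
    · rw [map_zero]
      exact ClosedIdeal.zero_mem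
    · intro x y hx hy
      rw [map_add]
      exact ClosedIdeal.add_mem hx hy
    · intro t b
      rw [I.incl.reduced_toReduced]
      exact toReduced_mem_reducedIdeal_iff.mpr b.2
  · refine I.incl.isClosed_range_reduced.closure_subset_iff.mpr fun x hx => ?_
    refine finSuppOf_induction (fun x => x ∈ Set.range I.incl.reduced) ⟨0, map_zero _⟩ ?_ ?_ hx
    · rintro _ _ ⟨a, rfl⟩ ⟨b, rfl⟩
      exact ⟨a + b, map_add _ _ _⟩
    · intro t b hb
      exact ⟨_, I.incl.reduced_toReduced (t := t) ⟨b, hb⟩⟩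

theorem proj_reduced_surjective : Function.Surjective I.proj.reduced :=
  I.proj.reduced_surjective fun t => (I.part t).mkQ_surjective

/-- The kernel of `p_r : C*_r(B) → C*_r(B/I)` consists of the `x` with `E(x* x) ∈ I_1`, by
faithfulness and naturality of the conditional expectations. -/
theorem proj_reduced_eq_zero_iff {x : B.Reduced} :
    I.proj.reduced x = 0 ↔ B.condExp (star x * x) ∈ I.part 1 := by
  rw [I.proj.reduced_eq_zero_iff]
  exact Submodule.Quotient.mk_eq_zero _

/-- Injectivity of `i_r`, surjectivity of `p_r` and `p_r ∘ i_r = 0` are automatic, so that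
exactness only asks that the kernel of `p_r` is contained in `C*_r(I)`. -/
theorem exactAt_iff : B.ExactAt I ↔ ∀ x, I.proj.reduced x = 0 → x ∈ B.reducedIdeal I := by
  have hrange : ∀ x, x ∈ Set.range I.incl.reduced ↔ x ∈ B.reducedIdeal I := fun x => by
    rw [I.range_incl_reduced]
    rfl
  refine ⟨fun h x hx => (hrange x).mp ((h.2.1 x).mp hx), fun h => ⟨?_, fun x => ?_, ?_⟩⟩
  · exact I.incl.reduced_injective (I.part 1).injective_subtype
  · rw [hrange]
    exact ⟨h x, fun hx => I.proj_reduced_eq_zero_iff.mpr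
      (condExp_mem_of_mem_reducedIdeal (ClosedIdeal.mul_mem_left _ hx))⟩
  · exact I.proj_reduced_surjective

theorem proj_reduced_toReduced_eq_zero_iff {t : G} {b : B.fiber t} :
    I.proj.reduced (B.toReduced t b) = 0 ↔ b ∈ I.part t := by
  rw [I.proj.reduced_toReduced, map_eq_zero_iff _ (I.quotient.toReduced_injective t)]
  exact Submodule.Quotient.mk_eq_zero _

end BundleIdeal

/-! ### The equivalences -/

/-- Since `I ↦ C*_r(I)` is always an order embedding, it is an isomorphism of lattices as soon as
each ideal `J` is generated by its intersections with the fibers. -/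
theorem exists_orderIso_iff :
    (∃ e : B.BundleIdeal ≃o ClosedIdeal B.Reduced, ∀ I : B.BundleIdeal, e I = B.reducedIdeal I) ↔
      ∀ J : ClosedIdeal B.Reduced, J ≤ B.reducedIdeal (fiberIdeal J) := by
  constructor
  · rintro ⟨e, he⟩ J
    have h : B.reducedIdeal (e.symm J) = J := by rw [← he, e.apply_symm_apply]
    conv_lhs => rw [← h]
    exact reducedIdeal_le_reducedIdeal_iff.mpr (reducedIdeal_le_iff.mp h.le)
  · intro h
    refine ⟨⟨⟨B.reducedIdeal, fiberIdeal, fun I => ?_, fun J => ?_⟩,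
      reducedIdeal_le_reducedIdeal_iff⟩, fun _ => rfl⟩
    · refine BundleIdeal.part_injective (funext fun t => Submodule.ext fun b => ?_)
      exact toReduced_mem_reducedIdeal_iff
    · exact le_antisymm (reducedIdeal_fiberIdeal_le J) (h J)

/-- If `ker p_r` is generated by its intersections with the fibers, it is `C*_r(I)`, because
`p_r(Λ_b) = 0` only for `b ∈ I_t`. -/
theorem hasExactness_of_le (h : ∀ J : ClosedIdeal B.Reduced, J ≤ B.reducedIdeal (fiberIdeal J)) :
    B.HasExactness := fun I => by
  refine I.exactAt_iff.mpr fun x hx => ?_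
  let K : ClosedIdeal B.Reduced := ClosedIdeal.ker I.proj.reduced I.proj.reduced_mul
  have hK : fiberIdeal K ≤ I := fun t b hb =>
    I.proj_reduced_toReduced_eq_zero_iff.mp (show I.proj.reduced (B.toReduced t b) = 0 from hb)
  exact reducedIdeal_le_reducedIdeal_iff.mpr hK x (h K x hx)

theorem diagonalInvariant_of_le
    (h : ∀ J : ClosedIdeal B.Reduced, J ≤ B.reducedIdeal (fiberIdeal J))
    (J : ClosedIdeal B.Reduced) : DiagonalInvariant J := by
  rw [← le_antisymm (reducedIdeal_fiberIdeal_le J) (h J)]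
  exact diagonalInvariant_reducedIdeal _

/-- If `J` is diagonal invariant and `x ∈ J`, then `E(x* x) ∈ J ∩ B_1`, so that `x` lies in the
kernel of `p_r` for the ideal `(J ∩ B_t)_t`. -/
theorem le_of_diagonalInvariant (hB : B.HasExactness) {J : ClosedIdeal B.Reduced}
    (hJ : DiagonalInvariant J) : J ≤ B.reducedIdeal (fiberIdeal J) := fun x hx =>
  (fiberIdeal J).exactAt_iff.mp (hB _) x ((fiberIdeal J).proj_reduced_eq_zero_iff.mpr
    (hJ _ (ClosedIdeal.mul_mem_left (star x) hx)))

/-- A nonzero ideal `K` of `C*_r(B/I)` meets `B_1/I_1`: otherwise the inverse image `J` of `K`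
satisfies `J ∩ B_1 ⊆ I_1`, hence `J ∩ B_t ⊆ I_t` for all `t`, and `J ⊆ C*_r(I)` is mapped
to `0`. -/
theorem hasResidualIntersection_of_le
    (h : ∀ J : ClosedIdeal B.Reduced, J ≤ B.reducedIdeal (fiberIdeal J)) :
    B.HasResidualIntersection := by
  rintro I K ⟨y, hy, hy0⟩
  by_contra! hK
  obtain ⟨x, rfl⟩ := I.proj_reduced_surjective y
  let J : ClosedIdeal B.Reduced := ClosedIdeal.comap I.proj.reduced I.proj.reduced_mul K
  have hJ : fiberIdeal J ≤ I := by
    intro t b hb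
    rw [BundleIdeal.mem_part_iff_ip] at hb ⊢
    rw [← I.proj_reduced_toReduced_eq_zero_iff, I.proj.reduced_toReduced]
    refine hK _ ?_
    rw [← I.proj.reduced_toReduced]
    exact hb
  have hx : x ∈ B.reducedIdeal I := reducedIdeal_le_reducedIdeal_iff.mpr hJ x (h J x hy)
  exact hy0 (I.proj_reduced_eq_zero_iff.mpr
    (condExp_mem_of_mem_reducedIdeal (ClosedIdeal.mul_mem_left _ hx)))

/-- With `I = (J ∩ B_t)_t`, exactness identifies `J / C*_r(I)` with an ideal of `C*_r(B/I)` that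
meets `B_1/I_1` only in `0`. -/
theorem le_of_hasResidualIntersection (hB : B.HasExactness) (hR : B.HasResidualIntersection)
    (J : ClosedIdeal B.Reduced) : J ≤ B.reducedIdeal (fiberIdeal J) := by
  intro x hx
  set I := fiberIdeal J
  have hker := I.exactAt_iff.mp (hB I)
  let K : ClosedIdeal I.quotient.Reduced := ClosedIdeal.map I.proj.reduced I.proj.reduced_mul
    I.proj_reduced_surjective J fun y hy => reducedIdeal_fiberIdeal_le J y (hker y hy)
  by_contra hx0
  obtain ⟨b, hbK, hb0⟩ := hR I K ⟨I.proj.reduced x, ⟨x, hx, rfl⟩, fun h => hx0 (hker x h)⟩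
  obtain ⟨a, rfl⟩ : ∃ a, I.proj.toLin 1 a = b := (I.part 1).mkQ_surjective b
  rw [← I.proj.reduced_toReduced] at hbK hb0
  exact hb0 (I.proj_reduced_toReduced_eq_zero_iff.mpr (ClosedIdeal.mem_map_iff.mp hbK))

end FellBundle

theorem theorem3p19 {G : Type u} [Group G] (B : FellBundle.{u, v} G) :
    List.TFAE
      [∃ e : B.BundleIdeal ≃o ClosedIdeal B.Reduced, ∀ I : B.BundleIdeal, e I = B.reducedIdeal I,
       B.HasExactness ∧ ∀ J : ClosedIdeal B.Reduced, FellBundle.DiagonalInvariant J,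
       B.HasExactness ∧ B.HasResidualIntersection] := by
  rw [FellBundle.exists_orderIso_iff]
  tfae_have 1 → 2 := fun h =>
    ⟨FellBundle.hasExactness_of_le h, FellBundle.diagonalInvariant_of_le h⟩
  tfae_have 2 → 1 := fun h J => FellBundle.le_of_diagonalInvariant h.1 (h.2 J)
  tfae_have 1 → 3 := fun h =>
    ⟨FellBundle.hasExactness_of_le h, FellBundle.hasResidualIntersection_of_le h⟩
  tfae_have 3 → 1 := fun h => FellBundle.le_of_hasResidualIntersection h.1 h.2
  tfae_finish
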